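/- There are at least $76$ pairwise non-isomorphic triangulations of the Klein bottle with $10$ vertices which admit a polyhedral immersion in $\mathbb{R}^3$ realizing an involutory symmetry; in $9$ of these cases the symmetry is a reflection in a plane, and in the remaining (at least) $67$ cases it is a rotation of order $2$. Here a triangulation of a surface $S$ is a two-dimensional simplicial complex $\Delta$ whose underlying space $|\Delta|$ is homeomorphic to $S$, and two triangulations are isomorphic if there is a bijection between their vertices which maps faces to faces in both directions. A polyhedral immersion of $\Delta$ is a locally injective map $\varphi\colon|\Delta|\to\mathbb{R}^3$ which is linear on every simplex (so that it is determined by the images of the vertices). It realizes an involutory symmetry $T$, where $T$ is an isometry of $\mathbb{R}^3$, if there is an automorphism $g$ of $\Delta$ of order $2$ such that $T\circ\varphi=\varphi\circ|g|$, where $|g|\colon|\Delta|\to|\Delta|$ is the map induced by $g$. -/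

import Mathlib

open scoped unitInterval

/-! ### Simplicial complexes: isomorphisms and geometric realization -/

/-- An isomorphism of abstract simplicial complexes: a bijection of the vertices under which a
finite set of vertices is a face if and only if its image is. -/
structure ComplexIso {V W : Type*} (K : AbstractSimplicialComplex V)
    (L : AbstractSimplicialComplex W) where
  /-- the underlying bijection of the vertices -/
  vertexEquiv : V ≃ W
  map_mem_iff : ∀ s : Finset V, s.map vertexEquiv.toEmbedding ∈ L.faces ↔ s ∈ K.faces

/-- The underlying space `|K|` of a simplicial complex with finitely many vertices, in barycentric
coordinates: nonnegative functions on the vertices which sum to `1` and whose support is a face.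
It carries the subspace topology of `V → ℝ`. -/
def UnderlyingSpace {V : Type*} [Fintype V] (K : AbstractSimplicialComplex V) : Type _ :=
  {x : V → ℝ // x ∈ stdSimplex ℝ V ∧ ∃ s ∈ K.faces, ∀ v, x v ≠ 0 ↔ v ∈ s}

instance UnderlyingSpace.instTopologicalSpace {V : Type*} [Fintype V]
    (K : AbstractSimplicialComplex V) : TopologicalSpace (UnderlyingSpace K) :=
  instTopologicalSpaceSubtype

/-- The map `|K| → |L|` induced by an isomorphism of simplicial complexes. -/
def ComplexIso.spaceMap {V W : Type*} [Fintype V] [Fintype W] {K : AbstractSimplicialComplex V}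
    {L : AbstractSimplicialComplex W} (e : ComplexIso K L) (x : UnderlyingSpace K) :
    UnderlyingSpace L :=
  ⟨fun w => x.1 (e.vertexEquiv.symm w),
    ⟨fun _ => x.2.1.1 _, (Equiv.sum_comp e.vertexEquiv.symm x.1).trans x.2.1.2⟩, by
    obtain ⟨s, hs, hx⟩ := x.2.2
    exact ⟨s.map e.vertexEquiv.toEmbedding, (e.map_mem_iff s).2 hs,
      fun w => (hx _).trans Finset.mem_map_equiv.symm⟩⟩

/-! ### The Klein bottle and its triangulations -/

/-- Generating identifications of boundary points of the unit square: the horizontal sides are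
glued by a translation, the vertical sides by a translation with a flip. -/
inductive KleinGluing : I × I → I × I → Prop
  | horizontal (x : I) : KleinGluing (x, 0) (x, 1)
  | vertical (y : I) : KleinGluing (0, y) (1, σ y)

/-- The Klein bottle, as a quotient space of the unit square (by the equivalence relation
generated by `KleinGluing`, with the quotient topology). -/
abbrev KleinBottle : Type := Quot KleinGluing

/-- `K` is a triangulation of the topological space `S`: a two-dimensional simplicial complex
whose underlying space is homeomorphic to `S`. -/
def IsTriangulationOf {V : Type*} [Fintype V] (K : AbstractSimplicialComplex V)
    (S : Type*) [TopologicalSpace S] : Prop :=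
  (∀ s ∈ K.faces, s.card ≤ 3) ∧ (∃ s ∈ K.faces, s.card = 3) ∧
    Nonempty (UnderlyingSpace K ≃ₜ S)

/-! ### Simplexwise linear maps and immersions -/

/-- The simplexwise linear map `|K| → ℝ³` induced by an assignment `ψ` of coordinates to the
vertices. -/
noncomputable def simplexwiseLinearMap {V : Type*} [Fintype V] (K : AbstractSimplicialComplex V)
    (ψ : V → EuclideanSpace ℝ (Fin 3)) (x : UnderlyingSpace K) : EuclideanSpace ℝ (Fin 3) :=
  ∑ v, x.1 v • ψ v

/-- The simplexwise linear map induced by `ψ` is a polyhedral immersion, i.e. locally injective. -/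
def IsPolyhedralImmersion {V : Type*} [Fintype V] (K : AbstractSimplicialComplex V)
    (ψ : V → EuclideanSpace ℝ (Fin 3)) : Prop :=
  IsLocallyInjective (simplexwiseLinearMap K ψ)

/-! ### Involutory isometries of space and symmetries -/

/-- `T` is the reflection of `ℝ³` in some (affine) plane. -/
def IsPlaneReflection (T : EuclideanSpace ℝ (Fin 3) ≃ᵃⁱ[ℝ] EuclideanSpace ℝ (Fin 3)) : Prop :=
  ∃ (p : AffineSubspace ℝ (EuclideanSpace ℝ (Fin 3))) (_ : Nonempty p),
    Module.finrank ℝ p.direction = 2 ∧ T = EuclideanGeometry.reflection p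

/-- `T` is a 2-fold rotation of `ℝ³`: the rotation by the angle `π` about some (affine) line, which
is the map sending each point `x` to `2 q - x`, with `q` the orthogonal projection of `x` to the
line. -/
def IsTwofoldRotation (T : EuclideanSpace ℝ (Fin 3) ≃ᵃⁱ[ℝ] EuclideanSpace ℝ (Fin 3)) : Prop :=
  ∃ (l : AffineSubspace ℝ (EuclideanSpace ℝ (Fin 3))) (_ : Nonempty l),
    Module.finrank ℝ l.direction = 1 ∧ T = EuclideanGeometry.reflection l

/-- The isometry `T` is an involutory geometric symmetry of the simplexwise linear map induced by
`ψ`: it is induced by an automorphism of `K` of order `2`. -/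
def IsInvolutorySymmetry {V : Type*} [Fintype V] (K : AbstractSimplicialComplex V)
    (ψ : V → EuclideanSpace ℝ (Fin 3))
    (T : EuclideanSpace ℝ (Fin 3) ≃ᵃⁱ[ℝ] EuclideanSpace ℝ (Fin 3)) : Prop :=
  ∃ g : ComplexIso K K, orderOf (g.vertexEquiv : Equiv.Perm V) = 2 ∧
    ∀ x : UnderlyingSpace K,
      T (simplexwiseLinearMap K ψ x) = simplexwiseLinearMap K ψ (g.spaceMap x)

/-!
# Symmetric immersed Klein bottles with ten vertices

The theorem is witnessed by 76 explicit triangulations with explicit integer positions of their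
vertices. Each of the required properties is reduced to a finite computation with natural numbers
and integers, which the kernel evaluates.

*Homeomorphism type.* A complex is represented by the polyhedron of its facets in barycentric
coordinates. A bistellar move `A * ∂B → ∂A * B` is realized by the explicit homeomorphism
`x ↦ x + min_A(x) (|A| / |B| · 1_B - 1_A)` (`bistellarHomeomorph`), so a sequence of edge flips
which ends at a given triangulation identifies its underlying space with that of a base
triangulation. The base is the 3 × 3 grid on the square with glued sides, with a tenth vertex placed
inside a triangle. For the grid the simplexwise linear map from the square is a sum of translates
of a hat function (`gridMap`); it is compatible with the gluing and onto, and it is injective up to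
the gluing because the sums of its coordinates over the columns and over the rows of the grid return
the position of the point (`gridMap_column`, `gridMap_row`). Hence it induces a homeomorphism of the
Klein bottle with the grid (`nonempty_kleinBottle_homeomorph_grid`).

*Pairwise non-isomorphism.* A sum over the vertices `u` of squares of weighted sums over the
triangles, with weights built from degrees and from adjacency to `u` (`facetInvariant`), is an
isomorphism invariant, and its 76 values are distinct.

*Immersion.* A simplexwise linear map is locally injective as soon as, at each vertex `v`, the cones
spanned by the triangles at `v` meet only along their common faces, for then it is injective on the
open star of `v` (`isPolyhedralImmersion_of_cones`). For two triangles at `v` this follows from the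
signs of a few determinants: if the cones over `A, B` and `C, D` meet outside the apex, then
`α A + β B = γ C + δ D` with nonnegative coefficients, and these are proportional to the
`3 × 3` determinants of the four vectors (`Relation.eq_zero_of_isSeparated`).

*Symmetry.* All immersions are normalized so that the symmetry is the half-turn about the third
coordinate axis or the reflection in the orthogonal plane; both are determined by their values on
the vertices (`isInvolutorySymmetry_realization`).
-/

/-! ### Polyhedra and bistellar moves -/

/-- The polyhedron spanned by a family `S` of vertex sets, in barycentric coordinates: the points
of the standard simplex whose support lies in a member of `S`. The family need not be closed under
subsets, so that a surface is given by its triangles. -/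
def polyhedron {V : Type*} [Fintype V] (S : Set (Finset V)) : Set (V → ℝ) :=
  {x | x ∈ stdSimplex ℝ V ∧ ∃ s ∈ S, ∀ v, x v ≠ 0 → v ∈ s}

section Bistellar

variable {V : Type*} [DecidableEq V]

/-- The piecewise linear map behind the bistellar move which replaces `A * ∂B` by `∂A * B`: the
mass that all vertices of `A` have in common is moved to the vertices of `B`. It sends the
barycenter of `A` to the barycenter of `B`. -/
noncomputable def bistellarMap (A B : Finset V) (hA : A.Nonempty) (x : V → ℝ) : V → ℝ :=
  fun v => x v + A.inf' hA x * ((if v ∈ B then (A.card / B.card : ℝ) else 0) -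
    if v ∈ A then 1 else 0)

theorem continuous_bistellarMap {A B : Finset V} (hA : A.Nonempty) :
    Continuous (bistellarMap A B hA) := by
  refine continuous_pi fun v => (continuous_apply v).add (Continuous.mul ?_ continuous_const)
  exact Continuous.finset_inf'_apply hA fun i _ => continuous_apply i

/-- The part of the hypotheses on a bistellar move from `S` to `S'` which is needed in order to map
`polyhedron S` to `polyhedron S'`; the other part is the same condition with `A`, `B` and `S`, `S'`
exchanged. -/
def IsBistellar (A B : Finset V) (S S' : Set (Finset V)) : Prop :=
  ∀ t ∈ S, ¬ B ⊆ t ∧ ((A ⊆ t ∧ ∀ a ∈ A, ∃ t' ∈ S', (t ∪ B).erase a ⊆ t') ∨ (¬ A ⊆ t ∧ t ∈ S'))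

/-- The result of the bistellar move on a family of facets. -/
def bistellarMove (A B : Finset V) (S : Set (Finset V)) : Set (Finset V) :=
  {t | (∃ a ∈ A, t = (A ∪ B).erase a) ∨ (t ∈ S ∧ ¬ A ⊆ t)}

variable [Fintype V]

theorem bistellarMap_mem {A B : Finset V} (hA : A.Nonempty) (hB : B.Nonempty)
    (hAB : Disjoint A B) {S S' : Set (Finset V)} (h : IsBistellar A B S S') {x : V → ℝ}
    (hx : x ∈ polyhedron S) : bistellarMap A B hA x ∈ polyhedron S' := by
  obtain ⟨⟨h0, h1⟩, t, ht, hxt⟩ := hx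
  have hm0 : 0 ≤ A.inf' hA x := Finset.le_inf' _ _ fun a _ => h0 a
  have hBc : (B.card : ℝ) ≠ 0 := by exact_mod_cast hB.card_pos.ne'
  refine ⟨⟨fun v => ?_, ?_⟩, ?_⟩
  · by_cases hv : v ∈ A
    · have hvB : v ∉ B := Finset.disjoint_left.1 hAB hv
      have := Finset.inf'_le x hv
      simp [bistellarMap, hv, hvB, this]
    · have : 0 ≤ (if v ∈ B then (A.card / B.card : ℝ) else 0) := by split_ifs <;> positivity
      have := mul_nonneg hm0 this
      simp only [bistellarMap, hv, if_false, sub_zero]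
      linarith [h0 v]
  · simp only [bistellarMap, Finset.sum_add_distrib, ← Finset.mul_sum, Finset.sum_sub_distrib,
      Finset.sum_ite_mem, Finset.univ_inter, Finset.sum_const, nsmul_eq_mul, h1]
    field_simp
    ring
  · obtain ⟨-, ⟨hAt, hS⟩ | ⟨hAt, hS⟩⟩ := h t ht
    · obtain ⟨a, ha, hma⟩ := Finset.exists_mem_eq_inf' hA x
      obtain ⟨t', ht', hsub⟩ := hS a ha
      refine ⟨t', ht', fun v hv => hsub (Finset.mem_erase.2 ⟨?_, ?_⟩)⟩
      · rintro rfl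
        exact hv (by simp [bistellarMap, ha, Finset.disjoint_left.1 hAB ha, hma])
      · by_contra hvt
        rw [Finset.mem_union, not_or] at hvt
        have hxv : x v = 0 := by by_contra h; exact hvt.1 (hxt v h)
        have hvA : v ∉ A := fun h => hvt.1 (hAt h)
        exact hv (by simp [bistellarMap, hvt.2, hxv, hvA])
    · obtain ⟨a, ha, hat⟩ := Finset.not_subset.1 hAt
      have hxa : x a = 0 := by by_contra h; exact hat (hxt a h)
      have hm : A.inf' hA x = 0 := le_antisymm (hxa ▸ Finset.inf'_le x ha) hm0
      exact ⟨t, hS, fun v hv => hxt v (by simpa [bistellarMap, hm] using hv)⟩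

/-- As `B` is not contained in the support of `x`, the common mass of `B` after the move is what the
move has added, so that the inverse move takes it back. -/
theorem bistellarMap_bistellarMap {A B : Finset V} (hA : A.Nonempty) (hB : B.Nonempty)
    (hAB : Disjoint A B) {S S' : Set (Finset V)} (h : IsBistellar A B S S') {x : V → ℝ}
    (hx : x ∈ polyhedron S) : bistellarMap B A hB (bistellarMap A B hA x) = x := by
  obtain ⟨⟨h0, h1⟩, t, ht, hxt⟩ := hx
  have hBc : (B.card : ℝ) ≠ 0 := by exact_mod_cast hB.card_pos.ne'
  have hAc : (A.card : ℝ) ≠ 0 := by exact_mod_cast hA.card_pos.ne'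
  obtain ⟨b, hb, hbt⟩ := Finset.not_subset.1 (h t ht).1
  have hxb : x b = 0 := by by_contra h; exact hbt (hxt b h)
  have hval : ∀ v ∈ B, bistellarMap A B hA x v = x v + A.inf' hA x * (A.card / B.card) :=
    fun v hv => by simp [bistellarMap, hv, Finset.disjoint_right.1 hAB hv]
  have hinf : B.inf' hB (bistellarMap A B hA x) = A.inf' hA x * (A.card / B.card) := by
    refine le_antisymm ?_ (Finset.le_inf' _ _ fun v hv => ?_)
    · refine (Finset.inf'_le _ hb).trans_eq ?_
      rw [hval b hb, hxb, zero_add]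
    · rw [hval v hv]
      linarith [h0 v]
  funext v
  conv_lhs => rw [bistellarMap, hinf]
  by_cases hvA : v ∈ A
  · have hvB := Finset.disjoint_left.1 hAB hvA
    simp only [bistellarMap, hvA, hvB, if_true, if_false]
    field_simp
    ring
  · by_cases hvB : v ∈ B
    · simp only [bistellarMap, hvA, hvB, if_true, if_false]
      ring
    · simp [bistellarMap, hvA, hvB]

/-- A bistellar move does not change the polyhedron, up to homeomorphism. -/
noncomputable def bistellarHomeomorph {A B : Finset V} (hA : A.Nonempty) (hB : B.Nonempty)
    (hAB : Disjoint A B) {S S' : Set (Finset V)} (h : IsBistellar A B S S')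
    (h' : IsBistellar B A S' S) : polyhedron S ≃ₜ polyhedron S' where
  toFun x := ⟨bistellarMap A B hA x, bistellarMap_mem hA hB hAB h x.2⟩
  invFun y := ⟨bistellarMap B A hB y, bistellarMap_mem hB hA hAB.symm h' y.2⟩
  left_inv x := Subtype.ext (bistellarMap_bistellarMap hA hB hAB h x.2)
  right_inv y := Subtype.ext (bistellarMap_bistellarMap hB hA hAB.symm h' y.2)
  continuous_toFun := ((continuous_bistellarMap hA).comp continuous_subtype_val).subtype_mk _
  continuous_invFun := ((continuous_bistellarMap hB).comp continuous_subtype_val).subtype_mk _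

/-- The move is a homeomorphism if the facets which contain `A` are those of `A * ∂B` and if `B`
does not occur before. -/
theorem nonempty_homeomorph_bistellarMove {A B : Finset V} (hA : A.Nonempty) (hB : B.Nonempty)
    (hAB : Disjoint A B) {S : Set (Finset V)} (h1 : ∀ t ∈ S, A ⊆ t → t ⊆ A ∪ B)
    (h2 : ∀ t ∈ S, ¬ B ⊆ t) (h3 : ∀ b ∈ B, ∃ t ∈ S, (A ∪ B).erase b ⊆ t) :
    Nonempty (polyhedron S ≃ₜ polyhedron (bistellarMove A B S)) := by
  refine ⟨bistellarHomeomorph hA hB hAB (fun t ht => ⟨h2 t ht, ?_⟩) ?_⟩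
  · by_cases hAt : A ⊆ t
    · refine Or.inl ⟨hAt, fun a ha => ⟨_, Or.inl ⟨a, ha, rfl⟩, Finset.erase_subset_erase _ ?_⟩⟩
      exact Finset.union_subset (h1 t ht hAt) Finset.subset_union_right
    · exact Or.inr ⟨hAt, Or.inr ⟨ht, hAt⟩⟩
  · rintro t (⟨a, ha, rfl⟩ | ⟨ht, hAt⟩)
    · have haB := Finset.disjoint_left.1 hAB ha
      refine ⟨fun h => Finset.notMem_erase a _ (h ha), Or.inl ⟨fun b hb => ?_, fun b hb => ?_⟩⟩
      · exact Finset.mem_erase.2 ⟨fun h => haB (h ▸ hb), Finset.mem_union_right _ hb⟩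
      · obtain ⟨t, ht, hsub⟩ := h3 b hb
        refine ⟨t, ht, (Finset.erase_subset_erase _ ?_).trans hsub⟩
        exact Finset.union_subset (Finset.erase_subset _ _) Finset.subset_union_left
    · exact ⟨hAt, Or.inr ⟨h2 t ht, ht⟩⟩

end Bistellar

/-! ### The grid triangulation of the Klein bottle -/

/-- The vertex of the triangulated Klein bottle at the point `(i, j)` of the grid `{0, …, 3}²`,
after the gluing: `(i, 3)` is `(i, 0)`, and `(3, j)` is `(0, 3 - j)`. -/
def gridVertex (i j : ℕ) : Fin 10 :=
  if i < 3 then Fin.ofNat 10 (3 * i + j % 3) else Fin.ofNat 10 ((3 - j) % 3)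

/-- The triangles of the grid: each unit square is cut by its diagonal from `(i, j)` to
`(i + 1, j + 1)`. -/
def gridTriangles : Set (Finset (Fin 10)) :=
  {t | ∃ i j, i < 3 ∧ j < 3 ∧
    (t = {gridVertex i j, gridVertex (i + 1) j, gridVertex (i + 1) (j + 1)} ∨
      t = {gridVertex i j, gridVertex i (j + 1), gridVertex (i + 1) (j + 1)})}

/-- The piecewise linear function on the plane, triangulated by the translates of the unit square
cut by its diagonal, which is `1` at the origin and `0` at the other lattice points. -/
noncomputable def hexHat (p q : ℝ) : ℝ := max 0 (1 - max (max p q) 0 + min (min p q) 0)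

theorem hexHat_eq_zero {p q : ℝ} (h : 1 ≤ p ∨ p ≤ -1 ∨ 1 ≤ q ∨ q ≤ -1) : hexHat p q = 0 := by
  refine max_eq_left ?_
  have h1 := le_max_right (max p q) 0
  have h2 := min_le_right (min p q) 0
  have h3 := (le_max_left p q).trans (le_max_left _ 0)
  have h4 := (le_max_right p q).trans (le_max_left _ 0)
  have h5 := (min_le_left (min p q) 0).trans (min_le_left p q)
  have h6 := (min_le_left (min p q) 0).trans (min_le_right p q)
  rcases h with h | h | h | h <;> linarith

section Corners

variable {u w : ℝ}

theorem hexHat_corner (hu : 0 ≤ u) (hw : 0 ≤ w) (hu1 : u ≤ 1) (hw1 : w ≤ 1) :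
    hexHat u w = 1 - max u w := by
  have : max u w ≤ 1 := max_le hu1 hw1
  rw [hexHat, max_eq_left (le_max_of_le_left hu), min_eq_right (le_min hu hw), add_zero,
    max_eq_right (by linarith)]

theorem hexHat_corner_right (hw : 0 ≤ w) (hu1 : u ≤ 1) :
    hexHat (u - 1) w = max (u - w) 0 := by
  rw [hexHat, min_eq_left (a := u - 1) (by linarith), max_eq_right (a := u - 1) (by linarith),
    max_eq_left hw, min_eq_left (by linarith), max_comm]
  congr 1
  ring

theorem hexHat_corner_top (hu : 0 ≤ u) (hw1 : w ≤ 1) :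
    hexHat u (w - 1) = max (w - u) 0 := by
  rw [hexHat, min_comm u, max_comm u]
  exact hexHat_corner_right hu hw1

theorem hexHat_corner_diag (hu : 0 ≤ u) (hw : 0 ≤ w) (hu1 : u ≤ 1) (hw1 : w ≤ 1) :
    hexHat (u - 1) (w - 1) = min u w := by
  have h : min (u - 1) (w - 1) = min u w - 1 := (min_sub_sub_right u w 1)
  have h0 : min u w ≤ 1 := (min_le_left _ _).trans hu1
  rw [hexHat, max_eq_right (max_le (by linarith) (by linarith)), h, min_eq_left (by linarith),
    max_eq_right (by linarith [le_min hu hw])]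
  ring

end Corners

/-- The simplexwise linear map from the square `[0, 3]²` to the triangulated Klein bottle, in
barycentric coordinates. -/
noncomputable def gridMap (s t : ℝ) : Fin 10 → ℝ :=
  ∑ i ∈ Finset.range 4, ∑ j ∈ Finset.range 4,
    hexHat (s - i) (t - j) • Pi.single (gridVertex i j) (1 : ℝ)

/-- On a square of the grid, the point is expressed by the corners of the square: by `(i, j)`,
`(i + 1, j + 1)` and one further corner, since one of the two middle coefficients vanishes. -/
theorem gridMap_cell {i j : ℕ} (hi : i < 3) (hj : j < 3) {u w : ℝ} (hu : 0 ≤ u) (hw : 0 ≤ w)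
    (hu1 : u ≤ 1) (hw1 : w ≤ 1) :
    gridMap (i + u) (j + w) = (1 - max u w) • Pi.single (gridVertex i j) (1 : ℝ) +
      max (u - w) 0 • Pi.single (gridVertex (i + 1) j) (1 : ℝ) +
      max (w - u) 0 • Pi.single (gridVertex i (j + 1)) (1 : ℝ) +
      min u w • Pi.single (gridVertex (i + 1) (j + 1)) (1 : ℝ) := by
  have key : ∀ a b : ℕ, hexHat (i + u - a) (j + w - b) =
      if a = i then (if b = j then 1 - max u w else if b = j + 1 then max (w - u) 0 else 0)
      else if a = i + 1 then
        (if b = j then max (u - w) 0 else if b = j + 1 then min u w else 0) else 0 := by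
    intro a b
    have far : ∀ {n m : ℕ} {r : ℝ}, 0 ≤ r → r ≤ 1 → n ≠ m → n ≠ m + 1 →
        1 ≤ (m : ℝ) + r - n ∨ (m : ℝ) + r - n ≤ -1 := by
      intro n m r h0 h1 hn hn'
      rcases lt_or_gt_of_ne hn with h | h
      · have : (n : ℝ) + 1 ≤ m := by exact_mod_cast h
        left; linarith
      · have : (m : ℝ) + 2 ≤ n := by exact_mod_cast (show m + 2 ≤ n by omega)
        right; linarith
    have near : ∀ (m : ℕ) (r : ℝ), (m : ℝ) + r - m = r := fun m r => by ring
    have next : ∀ (m : ℕ) (r : ℝ), (m : ℝ) + r - (m + 1 : ℕ) = r - 1 := fun m r => by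
      push_cast; ring
    by_cases ha : a = i
    · subst ha
      by_cases hb : b = j
      · subst hb
        simp [near, hexHat_corner hu hw hu1 hw1]
      · by_cases hb' : b = j + 1
        · subst hb'
          rw [near, next, hexHat_corner_top hu hw1]
          simp
        · rw [hexHat_eq_zero (Or.inr (Or.inr (far hw hw1 hb hb')))]
          simp [hb, hb']
    · by_cases ha' : a = i + 1
      · subst ha'
        by_cases hb : b = j
        · subst hb
          rw [near, next, hexHat_corner_right hw hu1]
          simp
        · by_cases hb' : b = j + 1
          · subst hb'
            rw [next, next, hexHat_corner_diag hu hw hu1 hw1]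
            simp
          · rw [hexHat_eq_zero (Or.inr (Or.inr (far hw hw1 hb hb')))]
            simp [hb, hb']
      · rw [hexHat_eq_zero ((far hu hu1 ha ha').imp_right Or.inl)]
        simp [ha, ha']
  simp only [gridMap, key]
  interval_cases i <;> interval_cases j <;> simp [Finset.sum_range_succ] <;> abel

theorem exists_cell {s : ℝ} (h0 : 0 ≤ s) (h3 : s ≤ 3) :
    ∃ (i : ℕ) (u : ℝ), i < 3 ∧ 0 ≤ u ∧ u ≤ 1 ∧ s = i + u := by
  rcases le_or_gt s 1 with h | h
  · exact ⟨0, s, by norm_num, h0, h, by simp⟩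
  rcases le_or_gt s 2 with h' | h'
  · exact ⟨1, s - 1, by norm_num, by linarith, by linarith, by simp⟩
  · exact ⟨2, s - 2, by norm_num, by linarith, by linarith, by simp⟩

/-- The coordinates of a point of a circle which is triangulated by three vertices and parametrized
by `[0, 3]`. -/
noncomputable def circleCoord (s : ℝ) (i : Fin 3) : ℝ :=
  ![max (1 - s) 0 + max (s - 2) 0, max (min s (2 - s)) 0, max (min (s - 1) (3 - s)) 0] i

theorem circleCoord_cell {i : ℕ} (hi : i < 3) {u : ℝ} (hu : 0 ≤ u) (hu1 : u ≤ 1) :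
    circleCoord (i + u) = (1 - u) • Pi.single (Fin.ofNat 3 i) (1 : ℝ) +
      u • Pi.single (Fin.ofNat 3 (i + 1)) (1 : ℝ) := by
  funext k
  interval_cases i <;> fin_cases k <;> simp [circleCoord, Fin.ofNat]
  all_goals grind

theorem circleCoord_injective {s s' : ℝ} (h0 : 0 ≤ s) (h3 : s ≤ 3) (h0' : 0 ≤ s') (h3' : s' ≤ 3)
    (h : circleCoord s = circleCoord s') : s = s' ∨ (s = 0 ∧ s' = 3) ∨ (s = 3 ∧ s' = 0) := by
  obtain ⟨i, u, hi, hu, hu1, rfl⟩ := exists_cell h0 h3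
  obtain ⟨i', u', hi', hu', hu1', rfl⟩ := exists_cell h0' h3'
  rw [circleCoord_cell hi hu hu1, circleCoord_cell hi' hu' hu1'] at h
  have e0 := congrFun h 0
  have e1 := congrFun h 1
  have e2 := congrFun h 2
  clear h h0 h3 h0' h3'
  interval_cases i <;> interval_cases i' <;> simp [Fin.ofNat] at e0 e1 e2 ⊢
  all_goals grind

/-- Summing over a column of the grid gives the horizontal position. -/
theorem gridMap_column {s t : ℝ} (hs0 : 0 ≤ s) (hs3 : s ≤ 3) (ht0 : 0 ≤ t) (ht3 : t ≤ 3)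
    (k : Fin 3) : ∑ l ∈ Finset.range 3, gridMap s t (gridVertex k l) = circleCoord s k := by
  obtain ⟨i, u, hi, hu, hu1, rfl⟩ := exists_cell hs0 hs3
  obtain ⟨j, w, hj, hw, hw1, rfl⟩ := exists_cell ht0 ht3
  rw [gridMap_cell hi hj hu hw hu1 hw1, circleCoord_cell hi hu hu1]
  clear hs0 hs3 ht0 ht3
  interval_cases i <;> interval_cases j <;> fin_cases k <;>
    simp [Finset.sum_range_succ, gridVertex, Fin.ofNat, Pi.single_apply] <;> grind

/-- Summing over the row of a grid square gives the vertical position, relative to the orientation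
of the square. -/
theorem gridMap_row {i : ℕ} (hi : i < 3) {u : ℝ} (hu : 0 ≤ u) (hu1 : u ≤ 1) {t : ℝ}
    (ht0 : 0 ≤ t) (ht3 : t ≤ 3) (k : Fin 3) :
    gridMap (i + u) t (gridVertex i k) + gridMap (i + u) t (gridVertex (i + 1) k) =
      circleCoord t k := by
  obtain ⟨j, w, hj, hw, hw1, rfl⟩ := exists_cell ht0 ht3
  rw [gridMap_cell hi hj hu hw hu1 hw1, circleCoord_cell hj hw hw1]
  clear ht0 ht3
  interval_cases i <;> interval_cases j <;> fin_cases k <;>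
    simp [gridVertex, Fin.ofNat] <;> grind

theorem gridMap_horizontal {s : ℝ} (h0 : 0 ≤ s) (h3 : s ≤ 3) : gridMap s 0 = gridMap s 3 := by
  obtain ⟨i, u, hi, hu, hu1, rfl⟩ := exists_cell h0 h3
  have h := gridMap_cell hi (j := 0) (by norm_num) hu le_rfl hu1 zero_le_one
  have h' := gridMap_cell hi (j := 2) (by norm_num) hu zero_le_one hu1 le_rfl
  norm_num at h h'
  rw [h, h', max_eq_left hu, max_eq_right hu1, min_eq_left hu1, min_eq_right hu]
  have e1 : gridVertex i 3 = gridVertex i 0 := by interval_cases i <;> rfl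
  have e2 : gridVertex (i + 1) 3 = gridVertex (i + 1) 0 := by interval_cases i <;> rfl
  rw [e1, e2, max_eq_left (by linarith : 0 ≤ 1 - u),
    max_eq_right (by linarith : u - 1 ≤ 0),
    max_eq_right (by linarith : -u ≤ 0)]
  simp

theorem gridMap_vertical {t : ℝ} (h0 : 0 ≤ t) (h3 : t ≤ 3) : gridMap 0 t = gridMap 3 (3 - t) := by
  obtain ⟨j, w, hj, hw, hw1, rfl⟩ := exists_cell h0 h3
  have h := gridMap_cell (i := 0) (by norm_num) hj le_rfl hw zero_le_one hw1
  have h' := gridMap_cell (i := 2) (j := 2 - j) (by norm_num) (by omega) zero_le_one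
    (sub_nonneg.2 hw1) le_rfl (by linarith : 1 - w ≤ 1)
  have e : ((2 : ℕ) : ℝ) + 1 = 3 := by norm_num
  have e' : ((2 - j : ℕ) : ℝ) + (1 - w) = 3 - (j + w) := by
    rw [Nat.cast_sub (by omega)]; push_cast; ring
  have e1 : gridVertex (2 + 1) (2 - j) = gridVertex 0 (j + 1) := by interval_cases j <;> rfl
  have e2 : gridVertex (2 + 1) (2 - j + 1) = gridVertex 0 j := by interval_cases j <;> rfl
  rw [e, e', e1, e2, max_eq_left (by linarith : 1 - w ≤ 1), min_eq_right (by linarith : 1 - w ≤ 1),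
    max_eq_left (by linarith : 0 ≤ 1 - (1 - w)), max_eq_right (by linarith : 1 - w - 1 ≤ 0)] at h'
  rw [Nat.cast_zero, zero_add, max_eq_right hw, max_eq_right (by linarith : 0 - w ≤ 0),
    max_eq_left (by linarith : 0 ≤ w - 0), min_eq_left hw] at h
  rw [h, h']
  simp
  abel

theorem gridMap_mem {s t : ℝ} (hs0 : 0 ≤ s) (hs3 : s ≤ 3) (ht0 : 0 ≤ t) (ht3 : t ≤ 3) :
    gridMap s t ∈ polyhedron gridTriangles := by
  obtain ⟨i, u, hi, hu, hu1, rfl⟩ := exists_cell hs0 hs3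
  obtain ⟨j, w, hj, hw, hw1, rfl⟩ := exists_cell ht0 ht3
  rw [gridMap_cell hi hj hu hw hu1 hw1]
  refine ⟨⟨fun v => ?_, ?_⟩, ?_⟩
  · have h1 : max u w ≤ 1 := max_le hu1 hw1
    have hs : ∀ a v, 0 ≤ (Pi.single a (1 : ℝ) : Fin 10 → ℝ) v := fun a v => by
      rw [Pi.single_apply]; split_ifs <;> norm_num
    simp only [Pi.add_apply, Pi.smul_apply, smul_eq_mul]
    have := mul_nonneg (sub_nonneg.2 h1) (hs (gridVertex i j) v)
    have := mul_nonneg (le_max_right (u - w) 0) (hs (gridVertex (i + 1) j) v)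
    have := mul_nonneg (le_max_right (w - u) 0) (hs (gridVertex i (j + 1)) v)
    have := mul_nonneg (le_min hu hw) (hs (gridVertex (i + 1) (j + 1)) v)
    linarith
  · simp only [Pi.add_apply, Pi.smul_apply, smul_eq_mul, Finset.sum_add_distrib, ← Finset.mul_sum,
      Finset.sum_pi_single', Finset.mem_univ, if_true]
    grind
  · rcases le_total w u with h | h
    · refine ⟨_, ⟨i, j, hi, hj, Or.inl rfl⟩, fun v hv => ?_⟩
      rw [max_eq_right (by linarith : w - u ≤ 0)] at hv
      by_contra hn
      simp only [Finset.mem_insert, Finset.mem_singleton, not_or] at hn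
      simp [hn.1, hn.2.1, hn.2.2] at hv
    · refine ⟨_, ⟨i, j, hi, hj, Or.inr rfl⟩, fun v hv => ?_⟩
      rw [max_eq_right (by linarith : u - w ≤ 0)] at hv
      by_contra hn
      simp only [Finset.mem_insert, Finset.mem_singleton, not_or] at hn
      simp [hn.1, hn.2.1, hn.2.2] at hv

theorem eq_single_of_support {V : Type*} [Fintype V] [DecidableEq V] {a b c : V} (hab : a ≠ b)
    (hac : a ≠ c) (hbc : b ≠ c) {z : V → ℝ} (hz : z ∈ stdSimplex ℝ V)
    (h : ∀ v, z v ≠ 0 → v ∈ ({a, b, c} : Finset V)) :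
    z a + z b + z c = 1 ∧
      z = z a • Pi.single a (1 : ℝ) + z b • Pi.single b (1 : ℝ) + z c • Pi.single c (1 : ℝ) := by
  constructor
  · rw [← hz.2, ← Finset.sum_subset (Finset.subset_univ {a, b, c})
      fun v _ hv => by by_contra h'; exact hv (h v h')]
    rw [Finset.sum_insert (by simp [hab, hac]), Finset.sum_pair hbc, add_assoc]
  · funext v
    by_cases hv : v ∈ ({a, b, c} : Finset V)
    · simp only [Finset.mem_insert, Finset.mem_singleton] at hv
      rcases hv with rfl | rfl | rfl
      · simp [hab, hac]
      · simp [hab.symm, hbc]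
      · simp [hac.symm, hbc.symm]
    · have hz0 : z v = 0 := by by_contra h'; exact hv (h v h')
      simp only [Finset.mem_insert, Finset.mem_singleton, not_or] at hv
      simp [hz0, hv.1, hv.2.1, hv.2.2]

/-- The map of the square is onto: a point of a triangle of the grid is the image of the point with
the same barycentric coordinates in the corresponding triangle of the square. -/
theorem exists_gridMap_eq {z : Fin 10 → ℝ} (hz : z ∈ polyhedron gridTriangles) :
    ∃ s t : ℝ, 0 ≤ s ∧ s ≤ 3 ∧ 0 ≤ t ∧ t ≤ 3 ∧ gridMap s t = z := by
  obtain ⟨hz, τ, ⟨i, j, hi, hj, h⟩, hτ⟩ := hz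
  have hi3 : (i : ℝ) ≤ 2 := by exact_mod_cast (show i ≤ 2 by omega)
  have hj3 : (j : ℝ) ≤ 2 := by exact_mod_cast (show j ≤ 2 by omega)
  have hi0 : (0 : ℝ) ≤ i := by positivity
  have hj0 : (0 : ℝ) ≤ j := by positivity
  have hne : gridVertex i j ≠ gridVertex (i + 1) j ∧ gridVertex i j ≠ gridVertex i (j + 1) ∧
      gridVertex i j ≠ gridVertex (i + 1) (j + 1) ∧
      gridVertex (i + 1) j ≠ gridVertex (i + 1) (j + 1) ∧
      gridVertex i (j + 1) ≠ gridVertex (i + 1) (j + 1) := by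
    clear hτ h hi3 hj3 hi0 hj0
    interval_cases i <;> interval_cases j <;> decide
  obtain ⟨n1, n2, n3, n4, n5⟩ := hne
  rcases h with rfl | rfl
  · obtain ⟨hsum, hzz⟩ := eq_single_of_support n1 n3 n4 hz hτ
    have hb := hz.1 (gridVertex (i + 1) j)
    have hc := hz.1 (gridVertex (i + 1) (j + 1))
    have ha := hz.1 (gridVertex i j)
    generalize z (gridVertex i j) = a at *
    generalize z (gridVertex (i + 1) j) = b at *
    generalize z (gridVertex (i + 1) (j + 1)) = c at *
    refine ⟨i + (b + c), j + c, by linarith, by linarith, by linarith, by linarith, ?_⟩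
    rw [gridMap_cell hi hj (by linarith) hc (by linarith) (by linarith), hzz,
      max_eq_left (by linarith : c ≤ b + c), max_eq_left (by linarith : 0 ≤ b + c - c),
      max_eq_right (by linarith : c - (b + c) ≤ 0), min_eq_right (by linarith : c ≤ b + c),
      zero_smul, add_zero, add_sub_cancel_right]
    rw [show 1 - (b + c) = a by linarith]
  · obtain ⟨hsum, hzz⟩ := eq_single_of_support n2 n3 n5 hz hτ
    have hb := hz.1 (gridVertex i (j + 1))
    have hc := hz.1 (gridVertex (i + 1) (j + 1))
    have ha := hz.1 (gridVertex i j)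
    generalize z (gridVertex i j) = a at *
    generalize z (gridVertex i (j + 1)) = b at *
    generalize z (gridVertex (i + 1) (j + 1)) = c at *
    refine ⟨i + c, j + (b + c), by linarith, by linarith, by linarith, by linarith, ?_⟩
    rw [gridMap_cell hi hj hc (by linarith) (by linarith) (by linarith), hzz,
      max_eq_right (by linarith : c ≤ b + c), max_eq_left (by linarith : 0 ≤ b + c - c),
      max_eq_right (by linarith : c - (b + c) ≤ 0), min_eq_left (by linarith : c ≤ b + c),
      zero_smul, add_zero, add_sub_cancel_right]
    rw [show 1 - (b + c) = a by linarith]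

theorem continuous_gridMap : Continuous fun p : I × I => gridMap (3 * p.1) (3 * p.2) := by
  unfold gridMap hexHat
  fun_prop

theorem three_mul_mem (x : I) : 0 ≤ 3 * (x : ℝ) ∧ 3 * (x : ℝ) ≤ 3 :=
  ⟨by linarith [x.2.1], by linarith [x.2.2]⟩

/-- `gridMap`, as a map from the unit square to the triangulated Klein bottle. -/
noncomputable def squareMap (p : I × I) : polyhedron gridTriangles :=
  ⟨gridMap (3 * p.1) (3 * p.2), gridMap_mem (three_mul_mem _).1 (three_mul_mem _).2
    (three_mul_mem _).1 (three_mul_mem _).2⟩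

theorem squareMap_eq_of_gluing {p q : I × I} (h : KleinGluing p q) : squareMap p = squareMap q := by
  apply Subtype.ext
  cases h with
  | horizontal x =>
    simpa [squareMap] using gridMap_horizontal (three_mul_mem x).1 (three_mul_mem x).2
  | vertical y =>
    have := gridMap_vertical (three_mul_mem y).1 (three_mul_mem y).2
    simpa [squareMap, mul_sub] using this

/-- Two points of the square with the same image are glued. The points on the vertical sides are
compared after moving one of them to the left side. -/
theorem quot_mk_eq_of_squareMap_eq {p q : I × I} (h : squareMap p = squareMap q) :
    (Quot.mk KleinGluing p) = Quot.mk KleinGluing q := by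
  have same : ∀ x y y' : I, squareMap (x, y) = squareMap (x, y') →
      (Quot.mk KleinGluing (x, y)) = Quot.mk KleinGluing (x, y') := by
    intro x y y' h
    have h := congrArg Subtype.val h
    change gridMap (3 * x) (3 * y) = gridMap (3 * x) (3 * y') at h
    obtain ⟨i, u, hi, hu, hu1, hx⟩ := exists_cell (three_mul_mem x).1 (three_mul_mem x).2
    have hc : circleCoord (3 * y) = circleCoord (3 * y') := by
      funext k
      rw [← gridMap_row hi hu hu1 (three_mul_mem y).1 (three_mul_mem y).2,
        ← gridMap_row hi hu hu1 (three_mul_mem y').1 (three_mul_mem y').2, ← hx, h]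
    rcases circleCoord_injective (three_mul_mem y).1 (three_mul_mem y).2 (three_mul_mem y').1
      (three_mul_mem y').2 hc with h | ⟨h, h'⟩ | ⟨h, h'⟩
    · rw [show y = y' from Subtype.ext (by linarith)]
    · rw [show y = 0 from Subtype.ext (by rw [Set.Icc.coe_zero]; linarith),
        show y' = 1 from Subtype.ext (by rw [Set.Icc.coe_one]; linarith)]
      exact Quot.sound (.horizontal x)
    · rw [show y = 1 from Subtype.ext (by rw [Set.Icc.coe_one]; linarith),
        show y' = 0 from Subtype.ext (by rw [Set.Icc.coe_zero]; linarith)]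
      exact (Quot.sound (.horizontal x)).symm
  have sides : ∀ y y' : I, squareMap (0, y) = squareMap (1, y') →
      (Quot.mk KleinGluing (0, y)) = Quot.mk KleinGluing (1, y') := by
    intro y y' h
    have hg : KleinGluing (0, σ y') (1, y') := by
      have := KleinGluing.vertical (σ y')
      rwa [unitInterval.symm_symm] at this
    exact (same 0 y (σ y') (h.trans (squareMap_eq_of_gluing hg).symm)).trans (Quot.sound hg)
  obtain ⟨x, y⟩ := p
  obtain ⟨x', y'⟩ := q
  have hc : circleCoord (3 * x) = circleCoord (3 * x') := by
    have h := congrArg Subtype.val h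
    change gridMap (3 * x) (3 * y) = gridMap (3 * x') (3 * y') at h
    funext k
    rw [← gridMap_column (three_mul_mem x).1 (three_mul_mem x).2 (three_mul_mem y).1
        (three_mul_mem y).2, h, gridMap_column (three_mul_mem x').1 (three_mul_mem x').2
        (three_mul_mem y').1 (three_mul_mem y').2]
  rcases circleCoord_injective (three_mul_mem x).1 (three_mul_mem x).2 (three_mul_mem x').1
    (three_mul_mem x').2 hc with hx | ⟨hx, hx'⟩ | ⟨hx, hx'⟩
  · obtain rfl : x = x' := Subtype.ext (by linarith)
    exact same x y y' h
  · obtain rfl : x = 0 := Subtype.ext (by rw [Set.Icc.coe_zero]; linarith)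
    obtain rfl : x' = 1 := Subtype.ext (by rw [Set.Icc.coe_one]; linarith)
    exact sides y y' h
  · obtain rfl : x = 1 := Subtype.ext (by rw [Set.Icc.coe_one]; linarith)
    obtain rfl : x' = 0 := Subtype.ext (by rw [Set.Icc.coe_zero]; linarith)
    exact (sides y' y h.symm).symm

/-- The grid triangulates the Klein bottle: a continuous bijection from a compact space to a
Hausdorff space is a homeomorphism. -/
theorem nonempty_kleinBottle_homeomorph_grid :
    Nonempty (KleinBottle ≃ₜ polyhedron gridTriangles) := by
  have hcont : Continuous squareMap := continuous_gridMap.subtype_mk _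
  let f : KleinBottle → polyhedron gridTriangles :=
    Quot.lift squareMap fun _ _ h => squareMap_eq_of_gluing h
  have hf : Continuous f := continuous_quot_lift _ hcont
  have hbij : Function.Bijective f := by
    constructor
    · rintro ⟨p⟩ ⟨q⟩ h
      exact quot_mk_eq_of_squareMap_eq h
    · rintro ⟨z, hz⟩
      obtain ⟨s, t, hs0, hs3, ht0, ht3, rfl⟩ := exists_gridMap_eq hz
      refine ⟨Quot.mk _ (⟨s / 3, by linarith, by linarith⟩, ⟨t / 3, by linarith, by linarith⟩),
        Subtype.ext ?_⟩
      change gridMap (3 * (s / 3)) (3 * (t / 3)) = gridMap s t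
      rw [mul_div_cancel₀ _ three_ne_zero, mul_div_cancel₀ _ three_ne_zero]
  exact ⟨Continuous.homeoOfEquivCompactToT2 (f := Equiv.ofBijective f hbij) hf⟩

/-! ### Complexes given by their facets -/

section FacetComplex

variable {V : Type*}

/-- The simplicial complex with the given facets (and all singletons, which Mathlib demands). -/
def facetComplex (S : Set (Finset V)) : AbstractSimplicialComplex V :=
  PreAbstractSimplicialComplex.addSingletons V
    ⟨{s | s.Nonempty ∧ ∃ t ∈ S, s ⊆ t}, fun _ ⟨hs, t, ht, hst⟩ =>
      ⟨hs, fun _ hrs hr => ⟨hr, t, ht, hrs.trans hst⟩⟩⟩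

theorem mem_facetComplex {S : Set (Finset V)} (hS : ∀ v, ∃ t ∈ S, v ∈ t) {s : Finset V} :
    s ∈ (facetComplex S).faces ↔ s.Nonempty ∧ ∃ t ∈ S, s ⊆ t := by
  refine ⟨?_, Or.inl⟩
  rintro (h | ⟨v, rfl⟩)
  · exact h
  · obtain ⟨t, ht, hv⟩ := hS v
    exact ⟨Finset.singleton_nonempty v, t, ht, Finset.singleton_subset_iff.2 hv⟩

/-- The underlying space of a complex is the polyhedron spanned by its facets. -/
noncomputable def underlyingSpaceHomeomorph [Fintype V] {S : Set (Finset V)}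
    (hS : ∀ v, ∃ t ∈ S, v ∈ t) : UnderlyingSpace (facetComplex S) ≃ₜ polyhedron S := by
  classical
  refine Homeomorph.setCongr (s := {x : V → ℝ | x ∈ stdSimplex ℝ V ∧
    ∃ s ∈ (facetComplex S).faces, ∀ v, x v ≠ 0 ↔ v ∈ s}) (Set.ext fun x => ?_)
  refine and_congr_right fun hx => ⟨?_, ?_⟩
  · rintro ⟨s, hs, hxs⟩
    obtain ⟨-, t, ht, hst⟩ := (mem_facetComplex hS).1 hs
    exact ⟨t, ht, fun v hv => hst ((hxs v).1 hv)⟩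
  · rintro ⟨t, ht, hxt⟩
    refine ⟨Finset.univ.filter (x · ≠ 0), (mem_facetComplex hS).2 ⟨?_, t, ht, fun v hv => ?_⟩,
      fun v => by simp⟩
    · rw [Finset.filter_nonempty_iff]
      by_contra! h
      have := hx.2
      rw [Finset.sum_congr rfl h, Finset.sum_const_zero] at this
      exact zero_ne_one this
    · exact hxt v (Finset.mem_filter.1 hv).2

end FacetComplex

/-! ### Vertex sets as bit masks -/

/-- The set of vertices encoded by the binary digits of `m`. -/
def vertexSet (m : ℕ) : Finset (Fin 10) := Finset.univ.filter fun v => m.testBit v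

/-- The bit mask of a list of vertices. -/
def mask (A : List ℕ) : ℕ := A.foldr (fun a m => 2 ^ a ||| m) 0

/-- The inclusion of bit masks. -/
def maskSubset (x y : ℕ) : Bool := x &&& y == x

theorem testBit_mask {A : List ℕ} {i : ℕ} : (mask A).testBit i = true ↔ i ∈ A := by
  induction A with
  | nil => simp [mask]
  | cons a A ih =>
    have : mask (a :: A) = 2 ^ a ||| mask A := rfl
    rw [this, Nat.testBit_or, Bool.or_eq_true, ih, Nat.testBit_two_pow, List.mem_cons]
    simp [eq_comm]

theorem mem_vertexSet {m : ℕ} {v : Fin 10} : v ∈ vertexSet m ↔ m.testBit v = true := by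
  simp [vertexSet]

theorem mem_vertexSet_mask {A : List ℕ} {v : Fin 10} : v ∈ vertexSet (mask A) ↔ (v : ℕ) ∈ A := by
  rw [mem_vertexSet, testBit_mask]

theorem vertexSet_mono {x y : ℕ} (h : maskSubset x y = true) : vertexSet x ⊆ vertexSet y := by
  intro v hv
  have h : x &&& y = x := by simpa [maskSubset] using h
  rw [mem_vertexSet] at hv ⊢
  rw [← h, Nat.testBit_and, Bool.and_eq_true] at hv
  exact hv.2

theorem maskSubset_mask {A : List ℕ} (hA : ∀ a ∈ A, a < 10) {y : ℕ} :
    maskSubset (mask A) y = true ↔ vertexSet (mask A) ⊆ vertexSet y := by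
  refine ⟨vertexSet_mono, fun h => ?_⟩
  rw [maskSubset, beq_iff_eq]
  refine Nat.eq_of_testBit_eq fun i => ?_
  rw [Nat.testBit_and]
  cases hi : (mask A).testBit i with
  | false => rfl
  | true =>
    have hi' := hA i (testBit_mask.1 hi)
    have := h (mem_vertexSet (v := ⟨i, hi'⟩).2 hi)
    rw [mem_vertexSet] at this
    simpa using this

theorem vertexSet_mask_append (A B : List ℕ) :
    vertexSet (mask (A ++ B)) = vertexSet (mask A) ∪ vertexSet (mask B) := by
  ext v
  simp [mem_vertexSet_mask]

theorem vertexSet_mask_three (a b c : Fin 10) :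
    vertexSet (mask [(a : ℕ), (b : ℕ), (c : ℕ)]) = {a, b, c} := by
  ext v
  simp [mem_vertexSet_mask, Fin.ext_iff]

/-- The family of vertex sets encoded by a list of masks. -/
def facets (l : List ℕ) : Set (Finset (Fin 10)) := {s | ∃ m ∈ l, s = vertexSet m}

/-! ### Bistellar moves on lists of masks -/

/-- The bistellar move which replaces `A * ∂B` by `∂A * B`. -/
def moveMasks (A B l : List ℕ) : List ℕ :=
  A.map (fun a => mask (A.erase a ++ B)) ++ l.filter fun m => !maskSubset (mask A) m

/-- The bistellar move is admissible: all of `A * ∂B` is present, no other facet contains `A`, and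
`B` is not a face. -/
def canMove (A B l : List ℕ) : Bool :=
  decide (A ++ B).Nodup && (A ++ B).all (· < 10) && !A.isEmpty && !B.isEmpty &&
  l.all (fun m => (!maskSubset (mask A) m || maskSubset m (mask (A ++ B))) &&
    !maskSubset (mask B) m) &&
  B.all fun b => l.any fun m => maskSubset (mask (A ++ B.erase b)) m

theorem nonempty_homeomorph_moveMasks {A B l : List ℕ} (h : canMove A B l = true) :
    Nonempty (polyhedron (facets l) ≃ₜ polyhedron (facets (moveMasks A B l))) := by
  simp only [canMove, Bool.and_eq_true, decide_eq_true_eq, List.all_eq_true, Bool.not_eq_true',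
    List.isEmpty_eq_false_iff, Bool.or_eq_true, List.any_eq_true] at h
  obtain ⟨⟨⟨⟨⟨hnd, hlt⟩, hA⟩, hB⟩, hl⟩, hBl⟩ := h
  obtain ⟨hndA, hndB, hdisj⟩ := List.nodup_append'.1 hnd
  have hltA : ∀ a ∈ A, a < 10 := fun a ha => hlt a (List.mem_append_left _ ha)
  have hltB : ∀ a ∈ B, a < 10 := fun a ha => hlt a (List.mem_append_right _ ha)
  have hne : ∀ {C : List ℕ}, C ≠ [] → (∀ c ∈ C, c < 10) → (vertexSet (mask C)).Nonempty := by
    intro C hC hlt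
    obtain ⟨c, hc⟩ := List.exists_mem_of_ne_nil _ hC
    exact ⟨⟨c, hlt c hc⟩, mem_vertexSet_mask.2 hc⟩
  have hD : Disjoint (vertexSet (mask A)) (vertexSet (mask B)) :=
    Finset.disjoint_left.2 fun v hv hv' =>
      hdisj (mem_vertexSet_mask.1 hv) (mem_vertexSet_mask.1 hv')
  have hset : facets (moveMasks A B l) =
      bistellarMove (vertexSet (mask A)) (vertexSet (mask B)) (facets l) := by
    have herase : ∀ a : Fin 10, (a : ℕ) ∈ A → vertexSet (mask (A.erase a ++ B)) =
        (vertexSet (mask A) ∪ vertexSet (mask B)).erase a := by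
      intro a ha
      ext v
      have : (a : ℕ) ∉ B := fun h => hdisj ha h
      simp only [mem_vertexSet_mask, List.mem_append, Finset.mem_erase, Finset.mem_union,
        hndA.mem_erase_iff, ne_eq, Fin.ext_iff]
      grind
    ext t
    constructor
    · rintro ⟨m, hm, rfl⟩
      rcases List.mem_append.1 hm with hm | hm
      · obtain ⟨a, ha, rfl⟩ := List.mem_map.1 hm
        exact Or.inl ⟨⟨a, hltA a ha⟩, mem_vertexSet_mask.2 ha, herase ⟨a, hltA a ha⟩ ha⟩
      · rw [List.mem_filter, Bool.not_eq_true', ← Bool.not_eq_true, maskSubset_mask hltA] at hm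
        exact Or.inr ⟨⟨m, hm.1, rfl⟩, hm.2⟩
    · rintro (⟨a, ha, rfl⟩ | ⟨⟨m, hm, rfl⟩, hmA⟩)
      · have ha := mem_vertexSet_mask.1 ha
        exact ⟨_, List.mem_append_left _ (List.mem_map.2 ⟨a, ha, rfl⟩), (herase a ha).symm⟩
      · refine ⟨m, List.mem_append_right _ (List.mem_filter.2 ⟨hm, ?_⟩), rfl⟩
        rwa [Bool.not_eq_true', ← Bool.not_eq_true, maskSubset_mask hltA]
  rw [hset]
  refine nonempty_homeomorph_bistellarMove (hne hA hltA) (hne hB hltB) hD ?_ ?_ ?_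
  · rintro _ ⟨m, hm, rfl⟩ hAm
    rw [← vertexSet_mask_append]
    rcases (hl m hm).1 with h | h
    · rw [← Bool.not_eq_true, maskSubset_mask hltA] at h
      exact absurd hAm h
    · exact vertexSet_mono h
  · rintro _ ⟨m, hm, rfl⟩ hBm
    have := (hl m hm).2
    rw [← Bool.not_eq_true, maskSubset_mask hltB] at this
    exact this hBm
  · intro b hb
    have hb := mem_vertexSet_mask.1 hb
    obtain ⟨m, hm, h⟩ := hBl b hb
    refine ⟨_, ⟨m, hm, rfl⟩, Finset.Subset.trans (fun v hv => ?_) (vertexSet_mono h)⟩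
    simp only [mem_vertexSet_mask, List.mem_append, Finset.mem_erase, Finset.mem_union,
      hndB.mem_erase_iff, ne_eq, Fin.ext_iff] at hv ⊢
    tauto

/-- The triangles of the grid, as masks. -/
def gridMasks : List ℕ :=
  (List.range 3).flatMap fun i => (List.range 3).flatMap fun j =>
    [mask [(gridVertex i j : ℕ), gridVertex (i + 1) j, gridVertex (i + 1) (j + 1)],
      mask [(gridVertex i j : ℕ), gridVertex i (j + 1), gridVertex (i + 1) (j + 1)]]

theorem facets_gridMasks : facets gridMasks = gridTriangles := by
  ext t
  simp only [facets, gridMasks, gridTriangles, List.mem_flatMap, List.mem_range, List.mem_cons,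
    List.not_mem_nil, or_false, Set.mem_ofPred_eq]
  constructor
  · rintro ⟨m, ⟨i, hi, j, hj, rfl | rfl⟩, rfl⟩
    · exact ⟨i, j, hi, hj, Or.inl (vertexSet_mask_three _ _ _)⟩
    · exact ⟨i, j, hi, hj, Or.inr (vertexSet_mask_three _ _ _)⟩
  · rintro ⟨i, j, hi, hj, rfl | rfl⟩
    · exact ⟨_, ⟨i, hi, j, hj, Or.inl rfl⟩, (vertexSet_mask_three _ _ _).symm⟩
    · exact ⟨_, ⟨i, hi, j, hj, Or.inr rfl⟩, (vertexSet_mask_three _ _ _).symm⟩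

/-- A triangulation of the Klein bottle with ten vertices, as masks: the grid, with the tenth vertex
placed inside a triangle. -/
def baseMasks : List ℕ := moveMasks [0, 6, 8] [9] gridMasks

theorem nonempty_kleinBottle_homeomorph_base :
    Nonempty (KleinBottle ≃ₜ polyhedron (facets baseMasks)) := by
  obtain ⟨e⟩ := nonempty_kleinBottle_homeomorph_grid
  obtain ⟨e'⟩ := nonempty_homeomorph_moveMasks (A := [0, 6, 8]) (B := [9]) (l := gridMasks)
    (by decide +kernel)
  rw [facets_gridMasks] at e'
  exact ⟨e.trans e'⟩

/-- The flips `fs` turn the list `l` of masks into the list `target`, up to order. A flip is encoded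
by four decimal digits `abcd`: the edge `ab` is replaced by the edge `cd`. -/
def flipsTo (target : List ℕ) : List ℕ → List ℕ → Bool
  | [], l => l.all (target.contains ·) && target.all (l.contains ·)
  | f :: fs, l =>
    canMove [f / 1000, f / 100 % 10] [f / 10 % 10, f % 10] l &&
      flipsTo target fs (moveMasks [f / 1000, f / 100 % 10] [f / 10 % 10, f % 10] l)

theorem nonempty_homeomorph_of_flipsTo {target fs l : List ℕ} (h : flipsTo target fs l = true) :
    Nonempty (polyhedron (facets l) ≃ₜ polyhedron (facets target)) := by
  induction fs generalizing l with
  | nil =>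
    simp only [flipsTo, Bool.and_eq_true, List.all_eq_true, List.contains_iff_mem] at h
    have : facets l = facets target := Set.ext fun t =>
      ⟨fun ⟨m, hm, ht⟩ => ⟨m, h.1 m hm, ht⟩, fun ⟨m, hm, ht⟩ => ⟨m, h.2 m hm, ht⟩⟩
    rw [this]
    exact ⟨Homeomorph.refl _⟩
  | cons f fs ih =>
    rw [flipsTo, Bool.and_eq_true] at h
    obtain ⟨e⟩ := nonempty_homeomorph_moveMasks h.1
    obtain ⟨e'⟩ := ih h.2
    exact ⟨e.trans e'⟩

/-! ### Triangulations given by lists of triangles -/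

/-- A triangle with the vertices `a < b < c` is encoded by the decimal number `abc`. -/
def triangleMask (n : ℕ) : ℕ := mask [n / 100, n / 10 % 10, n % 10]

/-- The digits of a code are increasing. -/
def isTriangle (n : ℕ) : Bool := n / 100 < n / 10 % 10 && n / 10 % 10 < n % 10

theorem exists_triangle_eq {n : ℕ} (h : isTriangle n = true) :
    ∃ a b c : Fin 10, n / 100 = a ∧ n / 10 % 10 = b ∧ n % 10 = c ∧ a ≠ b ∧ a ≠ c ∧ b ≠ c ∧
      vertexSet (triangleMask n) = {a, b, c} := by
  simp only [isTriangle, Bool.and_eq_true, decide_eq_true_eq] at h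
  have key : ∀ a b c : Fin 10, n / 100 = a → n / 10 % 10 = b → n % 10 = c →
      vertexSet (triangleMask n) = {a, b, c} := fun a b c ha hb hc => by
    rw [triangleMask, ha, hb, hc, vertexSet_mask_three]
  refine ⟨⟨n / 100, by omega⟩, ⟨n / 10 % 10, by omega⟩, ⟨n % 10, by omega⟩, rfl, rfl, rfl, ?_, ?_,
    ?_, key _ _ _ rfl rfl rfl⟩ <;> simp only [ne_eq, Fin.mk.injEq] <;> omega

/-- The simplicial complex with a given list of triangles. -/
def triangleComplex (l : List ℕ) : AbstractSimplicialComplex (Fin 10) :=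
  facetComplex (facets (l.map triangleMask))

/-- The codes in the list denote distinct triangles, which cover all vertices. -/
def isTriangleList (l : List ℕ) : Bool :=
  l.all isTriangle && decide (l.map triangleMask).Nodup &&
    (List.range 10).all fun v => (l.map triangleMask).any (·.testBit v)

section TriangleList

variable {l : List ℕ}

theorem isTriangle_of_mem (h : isTriangleList l = true) {n : ℕ} (hn : n ∈ l) :
    isTriangle n = true := by
  simp only [isTriangleList, Bool.and_eq_true, List.all_eq_true] at h
  exact h.1.1 n hn

theorem card_of_mem_facets (h : isTriangleList l = true) {t : Finset (Fin 10)}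
    (ht : t ∈ facets (l.map triangleMask)) : t.card = 3 := by
  obtain ⟨m, hm, rfl⟩ := ht
  obtain ⟨n, hn, rfl⟩ := List.mem_map.1 hm
  obtain ⟨a, b, c, -, -, -, hab, hac, hbc, e⟩ := exists_triangle_eq (isTriangle_of_mem h hn)
  rw [e, Finset.card_eq_three]
  exact ⟨a, b, c, hab, hac, hbc, rfl⟩

theorem exists_mem_facets (h : isTriangleList l = true) (v : Fin 10) :
    ∃ t ∈ facets (l.map triangleMask), v ∈ t := by
  simp only [isTriangleList, Bool.and_eq_true, List.all_eq_true, List.any_eq_true] at h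
  obtain ⟨m, hm, hv⟩ := h.2 v (List.mem_range.2 v.2)
  exact ⟨_, ⟨m, hm, rfl⟩, mem_vertexSet.2 hv⟩

theorem isTriangulationOf_kleinBottle (h : isTriangleList l = true) {fs : List ℕ}
    (hf : flipsTo (l.map triangleMask) fs baseMasks = true) :
    IsTriangulationOf (triangleComplex l) KleinBottle := by
  have hS := exists_mem_facets h
  refine ⟨fun s hs => ?_, ?_, ?_⟩
  · obtain ⟨-, t, ht, hst⟩ := (mem_facetComplex hS).1 hs
    exact (Finset.card_le_card hst).trans (card_of_mem_facets h ht).le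
  · obtain ⟨t, ht, h0⟩ := hS 0
    exact ⟨t, (mem_facetComplex hS).2 ⟨⟨0, h0⟩, t, ht, Finset.Subset.refl t⟩,
      card_of_mem_facets h ht⟩
  · obtain ⟨e⟩ := nonempty_kleinBottle_homeomorph_base
    obtain ⟨e'⟩ := nonempty_homeomorph_of_flipsTo hf
    exact ⟨(underlyingSpaceHomeomorph hS).trans (e.trans e').symm⟩

end TriangleList

/-! ### A combinatorial invariant -/

section Invariant

variable {V : Type*} [DecidableEq V]

/-- The number of members of `T` which contain both `u` and `w`; for `u = w`, the degree of `u`. -/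
def codegree (T : Finset (Finset V)) (u w : V) : ℕ := (T.filter fun t => u ∈ t ∧ w ∈ t).card

/-- An isomorphism invariant of the family `T`. The vertex `u` changes the weight of the vertices in
its star, so that the inner sum depends on the position of `u` in the complex. -/
def facetInvariant [Fintype V] (T : Finset (Finset V)) : ℕ :=
  ∑ u, (∑ t ∈ T, ∏ w ∈ t, (codegree T w w + codegree T u w)) ^ 2

theorem codegree_map (e : V ≃ V) (T : Finset (Finset V)) (u w : V) :
    codegree (T.map (Finset.mapEmbedding e.toEmbedding).toEmbedding) (e u) (e w) =
      codegree T u w := by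
  rw [codegree, Finset.filter_map, Finset.card_map, codegree]
  congr 1
  ext t
  simp [Finset.mapEmbedding_apply]

theorem facetInvariant_map [Fintype V] (e : V ≃ V) (T : Finset (Finset V)) :
    facetInvariant (T.map (Finset.mapEmbedding e.toEmbedding).toEmbedding) = facetInvariant T := by
  rw [facetInvariant, ← e.sum_comp]
  refine Finset.sum_congr rfl fun u _ => ?_
  rw [Finset.sum_map]
  congr 1
  refine Finset.sum_congr rfl fun t _ => ?_
  rw [RelEmbedding.coe_toEmbedding, Finset.mapEmbedding_apply, Finset.prod_map]
  refine Finset.prod_congr rfl fun w _ => ?_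
  rw [Equiv.coe_toEmbedding, codegree_map, codegree_map]

end Invariant

/-- An isomorphism between complexes whose facets all have `d` vertices maps facets to facets, since
these are the faces with `d` vertices. -/
theorem facetInvariant_eq_of_complexIso {V : Type*} [Fintype V] [DecidableEq V]
    {T T' : Finset (Finset V)} {d : ℕ} (hd : d ≠ 0) (hT : ∀ v, ∃ t ∈ (T : Set (Finset V)), v ∈ t)
    (hT' : ∀ v, ∃ t ∈ (T' : Set (Finset V)), v ∈ t) (hc : ∀ t ∈ T, t.card = d)
    (hc' : ∀ t ∈ T', t.card = d) (e : ComplexIso (facetComplex (T : Set (Finset V)))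
      (facetComplex (T' : Set (Finset V)))) : facetInvariant T = facetInvariant T' := by
  have mem_iff : ∀ {R : Finset (Finset V)}, (∀ v, ∃ t ∈ (R : Set (Finset V)), v ∈ t) →
      (∀ t ∈ R, t.card = d) → ∀ s : Finset V,
      s ∈ R ↔ s ∈ (facetComplex (R : Set (Finset V))).faces ∧ s.card = d := by
    intro R hR hcR s
    rw [mem_facetComplex hR]
    refine ⟨fun hs => ⟨⟨?_, s, hs, Finset.Subset.refl s⟩, hcR s hs⟩, ?_⟩
    · exact Finset.card_pos.1 (by rw [hcR s hs]; omega)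
    · rintro ⟨⟨-, t, ht, hst⟩, hs⟩
      rwa [Finset.eq_of_subset_of_card_le hst (by rw [hs, hcR t ht])]
  rw [← facetInvariant_map e.vertexEquiv T]
  congr 1
  ext s
  rw [Finset.mem_map]
  constructor
  · rintro ⟨t, ht, rfl⟩
    rw [mem_iff hT hc] at ht
    rw [mem_iff hT' hc', RelEmbedding.coe_toEmbedding, Finset.mapEmbedding_apply,
      e.map_mem_iff, Finset.card_map]
    exact ht
  · intro hs
    rw [mem_iff hT' hc'] at hs
    have hmap : (s.map e.vertexEquiv.symm.toEmbedding).map e.vertexEquiv.toEmbedding = s := by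
      ext v; simp
    refine ⟨s.map e.vertexEquiv.symm.toEmbedding, (mem_iff hT hc _).2 ⟨?_, ?_⟩, hmap⟩
    · rw [← e.map_mem_iff, hmap]; exact hs.1
    · rw [Finset.card_map]; exact hs.2

/-- The table of the numbers `codegree u w`, for a list of masks. -/
def codegreeTable (M : List ℕ) : List (List ℕ) :=
  (List.range 10).map fun u =>
    let N := M.filter (·.testBit u)
    (List.range 10).map fun w => N.countP (·.testBit w)

/-- The entry of a table of numbers in row `u` and column `w`. -/
def tableEntry (C : List (List ℕ)) (u w : ℕ) : ℕ := (C.getD u []).getD w 0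

/-- The value of `facetInvariant`, computed from the codes of the triangles. -/
def computeInvariant (l : List ℕ) : ℕ :=
  let C := codegreeTable (l.map triangleMask)
  ((List.range 10).map fun u =>
    let W := (List.range 10).map fun w => tableEntry C w w + tableEntry C u w
    (l.map fun n => W.getD (n / 100) 0 * W.getD (n / 10 % 10) 0 * W.getD (n % 10) 0).sum ^ 2).sum

theorem computeInvariant_eq {l : List ℕ} (h : isTriangleList l = true) :
    computeInvariant l =
      facetInvariant ((l.map fun n => vertexSet (triangleMask n)).toFinset) := by
  have hinj : ∀ n ∈ l, ∀ n' ∈ l, vertexSet (triangleMask n) = vertexSet (triangleMask n') →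
      triangleMask n = triangleMask n' := by
    have key : ∀ n ∈ l, ∀ n' ∈ l, vertexSet (triangleMask n) = vertexSet (triangleMask n') →
        ∀ i, (triangleMask n).testBit i = true → (triangleMask n').testBit i = true := by
      intro n hn n' hn' e i hi
      obtain ⟨a, b, c, ha, hb, hc, -⟩ := exists_triangle_eq (isTriangle_of_mem h hn)
      have hi' : i < 10 := by
        have := testBit_mask.1 hi
        simp only [ha, hb, hc, List.mem_cons, List.not_mem_nil, or_false] at this
        omega
      have := mem_vertexSet (v := ⟨i, hi'⟩).2 hi
      rw [e] at this
      exact mem_vertexSet.1 this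
    intro n hn n' hn' e
    exact Nat.eq_of_testBit_eq fun i =>
      Bool.eq_iff_iff.2 ⟨key n hn n' hn' e i, key n' hn' n hn e.symm i⟩
  have hnd : (l.map fun n => vertexSet (triangleMask n)).Nodup := by
    have hnd : (l.map triangleMask).Nodup := by
      simp only [isTriangleList, Bool.and_eq_true, decide_eq_true_eq] at h
      exact h.1.2
    refine List.Nodup.map_on (fun n hn n' hn' e => ?_) hnd.of_map
    exact List.inj_on_of_nodup_map hnd hn hn' (hinj n hn n' hn' e)
  have hcod : ∀ u w : Fin 10, tableEntry (codegreeTable (l.map triangleMask)) u w =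
      codegree (l.map fun n => vertexSet (triangleMask n)).toFinset u w := by
    intro u w
    have hfilter : (l.map fun n => vertexSet (triangleMask n)).toFinset.filter
        (fun t => u ∈ t ∧ w ∈ t) = ((l.map fun n => vertexSet (triangleMask n)).filter
        fun t => decide (u ∈ t ∧ w ∈ t)).toFinset := by
      ext t; simp
    rw [codegree, hfilter, List.toFinset_card_of_nodup (hnd.filter _),
      ← List.countP_eq_length_filter, List.countP_map]
    simp [tableEntry, codegreeTable, List.countP_filter, List.countP_map, Function.comp_def,
      mem_vertexSet, Bool.and_comm]
  have hrange : ∀ f : ℕ → ℕ, ((List.range 10).map f).sum = ∑ u : Fin 10, f u := fun f => by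
    rw [Fin.sum_univ_eq_sum_range]; rfl
  rw [facetInvariant, computeInvariant, hrange]
  refine Finset.sum_congr rfl fun u _ => ?_
  rw [List.sum_toFinset _ hnd, List.map_map]
  refine congrArg (fun L : List ℕ => L.sum ^ 2) ?_
  refine List.map_congr_left fun n hn => ?_
  obtain ⟨a, b, c, ha, hb, hc, hab, hac, hbc, e⟩ := exists_triangle_eq (isTriangle_of_mem h hn)
  have hW : ∀ w : Fin 10, ((List.range 10).map fun w =>
      tableEntry (codegreeTable (l.map triangleMask)) w w +
        tableEntry (codegreeTable (l.map triangleMask)) u w).getD w 0 =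
      codegree (l.map fun n => vertexSet (triangleMask n)).toFinset w w +
        codegree (l.map fun n => vertexSet (triangleMask n)).toFinset u w := by
    intro w
    rw [← hcod, ← hcod]
    simp
  rw [Function.comp_apply, e, Finset.prod_insert (by simp [hab, hac]), Finset.prod_pair hbc, ha, hb,
    hc, hW, hW, hW, mul_assoc]

/-- Lists of triangles with different invariants give non-isomorphic complexes. -/
theorem isEmpty_complexIso {l l' : List ℕ} (h : isTriangleList l = true)
    (h' : isTriangleList l' = true) (hne : computeInvariant l ≠ computeInvariant l') :
    IsEmpty (ComplexIso (triangleComplex l) (triangleComplex l')) := by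
  have hcoe : ∀ k : List ℕ, facets (k.map triangleMask) =
      ((k.map fun n => vertexSet (triangleMask n)).toFinset : Set (Finset (Fin 10))) := by
    intro k
    ext t
    simp [facets, eq_comm]
  refine ⟨fun e => hne ?_⟩
  have hS := exists_mem_facets h
  have hS' := exists_mem_facets h'
  have hc := fun t => card_of_mem_facets h (t := t)
  have hc' := fun t => card_of_mem_facets h' (t := t)
  unfold triangleComplex at e
  rw [hcoe] at hS hS' hc hc' e
  rw [hcoe] at e
  rw [computeInvariant_eq h, computeInvariant_eq h']
  exact facetInvariant_eq_of_complexIso three_ne_zero hS hS' hc hc' e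

/-! ### Local injectivity of simplexwise linear maps -/

section Cones

variable {V : Type*} [Fintype V]

/-- The cones which the map given by `ψ` has at `v` over the simplices `s` and `t` meet only in the
image of the common face: a vector which lies in both has the same coordinates in both. -/
def ConesMeetInFace (ψ : V → EuclideanSpace ℝ (Fin 3)) (v : V) (s t : Finset V) : Prop :=
  ∀ x y : V → ℝ, (∀ w, 0 ≤ x w) → (∀ w, 0 ≤ y w) → (∀ w, x w ≠ 0 → w ∈ s) →
    (∀ w, y w ≠ 0 → w ∈ t) → ∑ w, x w • (ψ w - ψ v) = ∑ w, y w • (ψ w - ψ v) →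
    ∀ w, w ≠ v → x w = y w

/-- It suffices for local injectivity that the cones at every vertex are embedded: then the map is
injective on the open star of each vertex, and the open stars cover the complex. -/
theorem isPolyhedralImmersion_of_cones {S : Set (Finset V)} (hS : ∀ v, ∃ t ∈ S, v ∈ t)
    {ψ : V → EuclideanSpace ℝ (Fin 3)}
    (h : ∀ v, ∀ s ∈ S, ∀ t ∈ S, v ∈ s → v ∈ t → ConesMeetInFace ψ v s t) :
    IsPolyhedralImmersion (facetComplex S) ψ := by
  classical
  intro x
  obtain ⟨v, hv⟩ : ∃ v, 0 < x.1 v := by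
    by_contra! hn
    have h1 : ∑ v, x.1 v = 1 := x.2.1.2
    rw [Finset.sum_congr rfl fun v _ => le_antisymm (hn v) (x.2.1.1 v), Finset.sum_const_zero] at h1
    exact zero_ne_one h1
  have hcont : Continuous fun y : UnderlyingSpace (facetComplex S) => y.1 v :=
    (continuous_apply v).comp continuous_subtype_val
  refine ⟨{y | 0 < y.1 v}, isOpen_lt continuous_const hcont, hv, fun y hy z hz hyz => ?_⟩
  have star : ∀ y : UnderlyingSpace (facetComplex S), 0 < y.1 v →
      ∃ s ∈ S, v ∈ s ∧ ∀ w, y.1 w ≠ 0 → w ∈ s := by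
    intro y hy
    obtain ⟨s, hs, hys⟩ := y.2.2
    obtain ⟨-, t, ht, hst⟩ := (mem_facetComplex hS).1 hs
    exact ⟨t, ht, hst ((hys v).1 hy.ne'), fun w hw => hst ((hys w).1 hw)⟩
  have shift : ∀ y : UnderlyingSpace (facetComplex S),
      ∑ w, y.1 w • (ψ w - ψ v) = simplexwiseLinearMap (facetComplex S) ψ y - ψ v := by
    intro y
    have h1 : ∑ v, y.1 v = 1 := y.2.1.2
    simp only [smul_sub, Finset.sum_sub_distrib, ← Finset.sum_smul, h1, one_smul,
      simplexwiseLinearMap]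
  obtain ⟨s, hs, hvs, hys⟩ := star y hy
  obtain ⟨t, ht, hvt, hzt⟩ := star z hz
  have key := h v s hs t ht hvs hvt y.1 z.1 y.2.1.1 z.2.1.1 hys hzt (by rw [shift, shift, hyz])
  refine Subtype.ext (funext fun w => ?_)
  by_cases hw : w = v
  · subst hw
    have hy1 : ∑ v, y.1 v = 1 := y.2.1.2
    have hz1 : ∑ v, z.1 v = 1 := z.2.1.2
    rw [← Finset.add_sum_erase _ _ (Finset.mem_univ w)] at hy1 hz1
    have := Finset.sum_congr rfl fun u (hu : u ∈ Finset.univ.erase w) =>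
      key u (Finset.ne_of_mem_erase hu)
    linarith
  · exact key w hw

theorem sum_smul_sub_of_support [DecidableEq V] {v a b : V} (hab : a ≠ b) (hva : v ≠ a)
    (hvb : v ≠ b) {x : V → ℝ} (ψ : V → EuclideanSpace ℝ (Fin 3))
    (hx : ∀ w, x w ≠ 0 → w ∈ ({v, a, b} : Finset V)) :
    ∑ w, x w • (ψ w - ψ v) = x a • (ψ a - ψ v) + x b • (ψ b - ψ v) := by
  rw [← Finset.sum_subset (Finset.subset_univ {v, a, b})
      fun w _ hw => by rw [not_not.1 (mt (hx w) hw), zero_smul]]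
  rw [Finset.sum_insert (by simp [hva, hvb]), Finset.sum_pair hab, sub_self, smul_zero, zero_add]

end Cones

/-! ### Cones over edges in space, in integer coordinates -/

/-- The cross product of integer vectors. -/
def crossZ (x y : ℤ × ℤ × ℤ) : ℤ × ℤ × ℤ :=
  (x.2.1 * y.2.2 - x.2.2 * y.2.1, x.2.2 * y.1 - x.1 * y.2.2, x.1 * y.2.1 - x.2.1 * y.1)

/-- The dot product of integer vectors. -/
def dotZ (x y : ℤ × ℤ × ℤ) : ℤ := x.1 * y.1 + x.2.1 * y.2.1 + x.2.2 * y.2.2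

/-- The real linear relation `α A + β B = γ C + δ D`, in coordinates. -/
def Relation (A B C D : ℤ × ℤ × ℤ) (α β γ δ : ℝ) : Prop :=
  α * A.1 + β * B.1 = γ * C.1 + δ * D.1 ∧ α * A.2.1 + β * B.2.1 = γ * C.2.1 + δ * D.2.1 ∧
    α * A.2.2 + β * B.2.2 = γ * C.2.2 + δ * D.2.2

/-- `A` and `B` are linearly independent. -/
def isIndependent (A B : ℤ × ℤ × ℤ) : Bool := 0 < dotZ (crossZ A B) (crossZ A B)

/-- The cones over `A, B` and `A, D` meet only in the ray of `A`: either `A, B, D` are linearly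
independent, or (as for triangles with a common edge on an axis of symmetry) `B` and `D` lie on
opposite sides of the line of `A`. -/
def isHinge (A B D : ℤ × ℤ × ℤ) : Bool :=
  dotZ (crossZ A B) D != 0 || dotZ (crossZ A B) (crossZ A D) < 0

/-- The cones over `A, B` and `C, D` meet only in the apex: by Cramer's rule, the coefficients of
the linear relation between the four vectors do not have the signs of such a common vector. -/
def isSeparated (A B C D : ℤ × ℤ × ℤ) : Bool :=
  let N := crossZ A B
  let N' := crossZ C D
  let a := dotZ N' B
  let b := dotZ N' A
  let c := dotZ N D
  let d := dotZ N C
  0 < a * b || 0 < c * d || a * d < 0 || b * c < 0 || 0 < a * c || 0 < b * d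

section Relations

variable {A B C D : ℤ × ℤ × ℤ} {α β γ δ : ℝ}

theorem Relation.symm (h : Relation A B C D α β γ δ) : Relation C D A B γ δ α β :=
  ⟨h.1.symm, h.2.1.symm, h.2.2.symm⟩

theorem Relation.swap_left (h : Relation A B C D α β γ δ) : Relation B A C D β α γ δ :=
  ⟨(add_comm _ _).trans h.1, (add_comm _ _).trans h.2.1, (add_comm _ _).trans h.2.2⟩

theorem Relation.eq_of_isIndependent (hi : isIndependent A B = true)
    (h : Relation A B A B α β γ δ) : α = γ ∧ β = δ := by
  obtain ⟨a1, a2, a3⟩ := A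
  obtain ⟨b1, b2, b3⟩ := B
  obtain ⟨h1, h2, h3⟩ := h
  have hi := (of_decide_eq_true hi).ne'
  simp only [dotZ, crossZ] at hi
  simp only at h1 h2 h3
  rify at hi
  -- The relation is paired with `B × (A × B)` and with `(A × B) × A`.
  constructor
  · refine sub_eq_zero.1 ((mul_eq_zero_iff_right hi).1 ?_)
    linear_combination
      (b2 * (a1 * b2 - a2 * b1 : ℝ) - b3 * (a3 * b1 - a1 * b3)) * h1 +
      (b3 * (a2 * b3 - a3 * b2 : ℝ) - b1 * (a1 * b2 - a2 * b1)) * h2 +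
      (b1 * (a3 * b1 - a1 * b3 : ℝ) - b2 * (a2 * b3 - a3 * b2)) * h3
  · refine sub_eq_zero.1 ((mul_eq_zero_iff_right hi).1 ?_)
    linear_combination
      -(a2 * (a1 * b2 - a2 * b1 : ℝ) - a3 * (a3 * b1 - a1 * b3)) * h1 -
      (a3 * (a2 * b3 - a3 * b2 : ℝ) - a1 * (a1 * b2 - a2 * b1)) * h2 -
      (a1 * (a3 * b1 - a1 * b3 : ℝ) - a2 * (a2 * b3 - a3 * b2)) * h3

theorem Relation.eq_of_isHinge (hi : isHinge A B D = true) (hβ : 0 ≤ β) (hδ : 0 ≤ δ)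
    (h : Relation A B A D α β γ δ) : α = γ ∧ β = 0 ∧ δ = 0 := by
  obtain ⟨a1, a2, a3⟩ := A
  obtain ⟨b1, b2, b3⟩ := B
  obtain ⟨d1, d2, d3⟩ := D
  obtain ⟨h1, h2, h3⟩ := h
  simp only at h1 h2 h3
  rcases (Bool.or_eq_true _ _).mp hi with hi | hi
  · have hi := bne_iff_ne.1 hi
    simp only [dotZ, crossZ] at hi
    rify at hi
    refine ⟨sub_eq_zero.1 ((mul_eq_zero_iff_right hi).1 ?_), (mul_eq_zero_iff_right hi).1 ?_,
      (mul_eq_zero_iff_right hi).1 ?_⟩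
    · linear_combination (b2 * d3 - b3 * d2 : ℝ) * h1 + (b3 * d1 - b1 * d3 : ℝ) * h2 +
        (b1 * d2 - b2 * d1 : ℝ) * h3
    · linear_combination -(a2 * d3 - a3 * d2 : ℝ) * h1 - (a3 * d1 - a1 * d3 : ℝ) * h2 -
        (a1 * d2 - a2 * d1 : ℝ) * h3
    · linear_combination -(a2 * b3 - a3 * b2 : ℝ) * h1 - (a3 * b1 - a1 * b3 : ℝ) * h2 -
        (a1 * b2 - a2 * b1 : ℝ) * h3
  · have hi := of_decide_eq_true hi
    simp only [dotZ, crossZ] at hi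
    rify at hi
    -- Write `N = A × B`, `N' = A × D`, `f = N ⬝ N' < 0`. The cross product of the relation with `A`
    -- is `β N = δ N'`, whose dot products with `N` and `N'` have sides of opposite signs.
    have e1 : β * ((a2 * b3 - a3 * b2 : ℝ) * (a2 * d3 - a3 * d2) +
        (a3 * b1 - a1 * b3) * (a3 * d1 - a1 * d3) + (a1 * b2 - a2 * b1) * (a1 * d2 - a2 * d1)) =
        δ * ((a2 * d3 - a3 * d2 : ℝ) ^ 2 + (a3 * d1 - a1 * d3) ^ 2 + (a1 * d2 - a2 * d1) ^ 2) := by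
      linear_combination
        -(a2 * (a1 * d2 - a2 * d1 : ℝ) - a3 * (a3 * d1 - a1 * d3)) * h1 -
        (a3 * (a2 * d3 - a3 * d2 : ℝ) - a1 * (a1 * d2 - a2 * d1)) * h2 -
        (a1 * (a3 * d1 - a1 * d3 : ℝ) - a2 * (a2 * d3 - a3 * d2)) * h3
    have e2 : β * ((a2 * b3 - a3 * b2 : ℝ) ^ 2 + (a3 * b1 - a1 * b3) ^ 2 +
        (a1 * b2 - a2 * b1) ^ 2) = δ * ((a2 * b3 - a3 * b2 : ℝ) * (a2 * d3 - a3 * d2) +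
        (a3 * b1 - a1 * b3) * (a3 * d1 - a1 * d3) + (a1 * b2 - a2 * b1) * (a1 * d2 - a2 * d1)) := by
      linear_combination
        -(a2 * (a1 * b2 - a2 * b1 : ℝ) - a3 * (a3 * b1 - a1 * b3)) * h1 -
        (a3 * (a2 * b3 - a3 * b2 : ℝ) - a1 * (a1 * b2 - a2 * b1)) * h2 -
        (a1 * (a3 * b1 - a1 * b3 : ℝ) - a2 * (a2 * b3 - a3 * b2)) * h3
    have hβ0 : β = 0 := (mul_eq_zero_iff_right hi.ne).1
      (le_antisymm (mul_nonpos_of_nonneg_of_nonpos hβ hi.le) (e1 ▸ by positivity))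
    have hδ0 : δ = 0 := (mul_eq_zero_iff_right hi.ne).1
      (le_antisymm (mul_nonpos_of_nonneg_of_nonpos hδ hi.le) (e2 ▸ by positivity))
    refine ⟨sub_eq_zero.1 ((mul_eq_zero_iff_right hi.ne).1 ?_), hβ0, hδ0⟩
    rw [hβ0, zero_mul, add_zero] at h1 h2 h3
    rw [hδ0, zero_mul, add_zero] at h1 h2 h3
    linear_combination
      (b2 * (a1 * d2 - a2 * d1 : ℝ) - b3 * (a3 * d1 - a1 * d3)) * h1 +
      (b3 * (a2 * d3 - a3 * d2 : ℝ) - b1 * (a1 * d2 - a2 * d1)) * h2 +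
      (b1 * (a3 * d1 - a1 * d3 : ℝ) - b2 * (a2 * d3 - a3 * d2)) * h3

theorem eq_zero_of_mul_add_mul {x y p q : ℝ} (hpq : 0 < p * q) (hx : 0 ≤ x) (hy : 0 ≤ y)
    (h : x * p + y * q = 0) : x = 0 ∧ y = 0 := by
  have hp : p ≠ 0 := left_ne_zero_of_mul hpq.ne'
  have hq : q ≠ 0 := right_ne_zero_of_mul hpq.ne'
  have h1 : x * p ^ 2 + y * (p * q) = 0 := by linear_combination p * h
  have h2 := mul_nonneg hx (sq_nonneg p)
  have h3 := mul_nonneg hy hpq.le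
  exact ⟨(mul_eq_zero_iff_right (pow_ne_zero 2 hp)).1 (by linarith),
    (mul_eq_zero_iff_right hpq.ne').1 (by linarith)⟩

theorem Relation.eq_zero_of_isSeparated (hi : isSeparated A B C D = true) (hα : 0 ≤ α)
    (hβ : 0 ≤ β) (hγ : 0 ≤ γ) (hδ : 0 ≤ δ) (h : Relation A B C D α β γ δ) :
    α = 0 ∧ β = 0 ∧ γ = 0 ∧ δ = 0 := by
  obtain ⟨a1, a2, a3⟩ := A
  obtain ⟨b1, b2, b3⟩ := B
  obtain ⟨c1, c2, c3⟩ := C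
  obtain ⟨d1, d2, d3⟩ := D
  obtain ⟨h1, h2, h3⟩ := h
  simp only [isSeparated, Bool.or_eq_true, decide_eq_true_eq] at hi
  simp only [dotZ, crossZ] at hi
  simp only at h1 h2 h3
  rify at hi
  set a : ℝ := (c2 * d3 - c3 * d2) * b1 + (c3 * d1 - c1 * d3) * b2 + (c1 * d2 - c2 * d1) * b3
    with ha
  set b : ℝ := (c2 * d3 - c3 * d2) * a1 + (c3 * d1 - c1 * d3) * a2 + (c1 * d2 - c2 * d1) * a3
    with hb
  set c : ℝ := (a2 * b3 - a3 * b2) * d1 + (a3 * b1 - a1 * b3) * d2 + (a1 * b2 - a2 * b1) * d3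
    with hc
  set d : ℝ := (a2 * b3 - a3 * b2) * c1 + (a3 * b1 - a1 * b3) * c2 + (a1 * b2 - a2 * b1) * c3
    with hd
  -- The dot products of the relation with the cross products of two of the four vectors.
  have ab : α * b + β * a = 0 := by
    linear_combination (c2 * d3 - c3 * d2 : ℝ) * h1 + (c3 * d1 - c1 * d3 : ℝ) * h2 +
      (c1 * d2 - c2 * d1 : ℝ) * h3
  have cd : γ * d + δ * c = 0 := by
    linear_combination -(a2 * b3 - a3 * b2 : ℝ) * h1 - (a3 * b1 - a1 * b3 : ℝ) * h2 -
      (a1 * b2 - a2 * b1 : ℝ) * h3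
  have ad : α * d - δ * a = 0 := by
    linear_combination (b2 * c3 - b3 * c2 : ℝ) * h1 + (b3 * c1 - b1 * c3 : ℝ) * h2 +
      (b1 * c2 - b2 * c1 : ℝ) * h3
  have bc : β * c - γ * b = 0 := by
    linear_combination -(a2 * d3 - a3 * d2 : ℝ) * h1 - (a3 * d1 - a1 * d3 : ℝ) * h2 -
      (a1 * d2 - a2 * d1 : ℝ) * h3
  have ac : α * c + γ * a = 0 := by
    linear_combination (b2 * d3 - b3 * d2 : ℝ) * h1 + (b3 * d1 - b1 * d3 : ℝ) * h2 +
      (b1 * d2 - b2 * d1 : ℝ) * h3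
  have bd : β * d + δ * b = 0 := by
    linear_combination -(a2 * c3 - a3 * c2 : ℝ) * h1 - (a3 * c1 - a1 * c3 : ℝ) * h2 -
      (a1 * c2 - a2 * c1 : ℝ) * h3
  clear_value a b c d
  rcases hi with ((((hi | hi) | hi) | hi) | hi) | hi
  · obtain ⟨rfl, rfl⟩ := eq_zero_of_mul_add_mul (mul_comm a b ▸ hi) hα hβ ab
    have z := fun {x : ℝ} => (mul_eq_zero_iff_right (a := x) (left_ne_zero_of_mul hi.ne')).1
    exact ⟨rfl, rfl, z (by linarith), z (by linarith)⟩
  · obtain ⟨rfl, rfl⟩ := eq_zero_of_mul_add_mul (mul_comm c d ▸ hi) hγ hδ cd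
    have z := fun {x : ℝ} => (mul_eq_zero_iff_right (a := x) (left_ne_zero_of_mul hi.ne')).1
    exact ⟨z (by linarith), z (by linarith), rfl, rfl⟩
  · obtain ⟨rfl, rfl⟩ := eq_zero_of_mul_add_mul (p := d) (q := -a) (by linarith) hα hδ (by linarith)
    have z := fun {x : ℝ} => (mul_eq_zero_iff_right (a := x) (left_ne_zero_of_mul hi.ne)).1
    exact ⟨rfl, z (by linarith), z (by linarith), rfl⟩
  · obtain ⟨rfl, rfl⟩ := eq_zero_of_mul_add_mul (p := c) (q := -b) (by linarith) hβ hγ (by linarith)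
    have z := fun {x : ℝ} => (mul_eq_zero_iff_right (a := x) (left_ne_zero_of_mul hi.ne)).1
    exact ⟨z (by linarith), rfl, rfl, z (by linarith)⟩
  · obtain ⟨rfl, rfl⟩ := eq_zero_of_mul_add_mul (mul_comm a c ▸ hi) hα hγ ac
    have z := fun {x : ℝ} => (mul_eq_zero_iff_right (a := x) (left_ne_zero_of_mul hi.ne')).1
    exact ⟨rfl, z (by linarith), rfl, z (by linarith)⟩
  · obtain ⟨rfl, rfl⟩ := eq_zero_of_mul_add_mul (mul_comm b d ▸ hi) hβ hδ bd
    have z := fun {x : ℝ} => (mul_eq_zero_iff_right (a := x) (left_ne_zero_of_mul hi.ne')).1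
    exact ⟨z (by linarith), rfl, z (by linarith), rfl⟩

end Relations

/-! ### Deciding whether a simplexwise linear map is an immersion -/

/-- An edge of the link of a vertex: its end points, with their positions relative to the vertex. -/
abbrev LinkEdge : Type := (ℕ × ℤ × ℤ × ℤ) × ℕ × ℤ × ℤ × ℤ

/-- The cones over two edges of a link meet only in the cone over their common part. -/
def conesCheck (e f : LinkEdge) : Bool :=
  if e.1.1 == f.1.1 then
    if e.2.1 == f.2.1 then isIndependent e.1.2 e.2.2 else isHinge e.1.2 e.2.2 f.2.2
  else if e.2.1 == f.2.1 then isHinge e.2.2 e.1.2 f.1.2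
  else if e.1.1 == f.2.1 then isHinge e.1.2 e.2.2 f.1.2
  else if e.2.1 == f.1.1 then isHinge e.2.2 e.1.2 f.2.2
  else isSeparated e.1.2 e.2.2 f.1.2 f.2.2

theorem eq_of_conesCheck {X : ℕ → ℤ × ℤ × ℤ} {i j k l : ℕ}
    (h : conesCheck ((i, X i), j, X j) ((k, X k), l, X l) = true) {α β γ δ : ℝ} (hα : 0 ≤ α)
    (hβ : 0 ≤ β) (hγ : 0 ≤ γ) (hδ : 0 ≤ δ) (hr : Relation (X i) (X j) (X k) (X l) α β γ δ)
    (w : ℕ) : (if w = i then α else 0) + (if w = j then β else 0) =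
      (if w = k then γ else 0) + (if w = l then δ else 0) := by
  simp only [conesCheck, beq_iff_eq] at h
  split_ifs at h with h1 h2 h2 h3 h4
  · subst h1 h2
    obtain ⟨rfl, rfl⟩ := hr.eq_of_isIndependent h
    rfl
  · subst h1
    obtain ⟨rfl, rfl, rfl⟩ := hr.eq_of_isHinge h hβ hδ
    simp
  · subst h2
    obtain ⟨rfl, rfl, rfl⟩ := hr.swap_left.symm.swap_left.symm.eq_of_isHinge h hα hγ
    simp
  · subst h3
    obtain ⟨rfl, rfl, rfl⟩ := hr.symm.swap_left.symm.eq_of_isHinge h hβ hγ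
    simp
  · subst h4
    obtain ⟨rfl, rfl, rfl⟩ := hr.swap_left.eq_of_isHinge h hα hδ
    simp
  · obtain ⟨rfl, rfl, rfl, rfl⟩ := hr.eq_zero_of_isSeparated h hα hβ hγ hδ
    simp

/-- The relation `r` holds for any two members of a list, at least in one order. -/
def pairwiseAll {α : Type*} (r : α → α → Bool) : List α → Bool
  | [] => true
  | a :: l => (a :: l).all (r a) && pairwiseAll r l

theorem pairwiseAll_iff {α : Type*} {r : α → α → Bool} {l : List α}
    (h : pairwiseAll r l = true) : ∀ a ∈ l, ∀ b ∈ l, r a b = true ∨ r b a = true := by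
  induction l with
  | nil => simp
  | cons c l ih =>
    rw [pairwiseAll, Bool.and_eq_true, List.all_eq_true] at h
    intro a ha b hb
    rcases List.mem_cons.1 ha with rfl | ha'
    · exact Or.inl (h.1 b hb)
    · rcases List.mem_cons.1 hb with rfl | hb'
      · exact Or.inr (h.1 a ha)
      · exact ih h.2 a ha' b hb'

/-- The position of the vertex `w`, in a list of positions. -/
def position (c : List (ℤ × ℤ × ℤ)) (w : ℕ) : ℤ × ℤ × ℤ := c.getD w 0

/-- The edges of the link of the vertex `v`, with relative positions `X`. -/
def linkEdges (X : ℕ → ℤ × ℤ × ℤ) (v : ℕ) (l : List ℕ) : List LinkEdge :=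
  l.filterMap fun n =>
    let a := n / 100
    let b := n / 10 % 10
    let c := n % 10
    if a == v then some ((b, X b), c, X c)
    else if b == v then some ((a, X a), c, X c)
    else if c == v then some ((a, X a), b, X b)
    else none

/-- The cones at every vertex are embedded. -/
def immersionCheck (l : List ℕ) (c : List (ℤ × ℤ × ℤ)) : Bool :=
  (List.range 10).all fun v =>
    pairwiseAll conesCheck (linkEdges (fun w => position c w - position c v) v l)

/-- The positions of the vertices, as points of Euclidean space. -/
noncomputable def realization (c : List (ℤ × ℤ × ℤ)) (v : Fin 10) : EuclideanSpace ℝ (Fin 3) :=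
  !₂[((position c v).1 : ℝ), ((position c v).2.1 : ℝ), ((position c v).2.2 : ℝ)]

/-- Each triangle at `v` contributes its edge opposite to `v` to the list of link edges. -/
theorem exists_linkEdge {l : List ℕ} (h : isTriangleList l = true) (X : ℕ → ℤ × ℤ × ℤ)
    {v : Fin 10} {t : Finset (Fin 10)} (ht : t ∈ facets (l.map triangleMask)) (hv : v ∈ t) :
    ∃ i j : Fin 10, i ≠ j ∧ v ≠ i ∧ v ≠ j ∧ t = {v, i, j} ∧
      (((i : ℕ), X i), (j : ℕ), X j) ∈ linkEdges X v l := by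
  obtain ⟨m, hm, rfl⟩ := ht
  obtain ⟨n, hn, rfl⟩ := List.mem_map.1 hm
  obtain ⟨a, b, c, ha, hb, hc, hab, hac, hbc, e⟩ := exists_triangle_eq (isTriangle_of_mem h hn)
  rw [e] at hv ⊢
  simp only [Finset.mem_insert, Finset.mem_singleton] at hv
  have hab' : (a : ℕ) ≠ b := fun h => hab (Fin.ext h)
  have hac' : (a : ℕ) ≠ c := fun h => hac (Fin.ext h)
  have hbc' : (b : ℕ) ≠ c := fun h => hbc (Fin.ext h)
  have hmem : ∀ x, (if (a : ℕ) == v then some (((b : ℕ), X b), (c : ℕ), X c)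
    else if (b : ℕ) == v then some (((a : ℕ), X a), (c : ℕ), X c)
    else if (c : ℕ) == v then some (((a : ℕ), X a), (b : ℕ), X b) else none) = some x →
      x ∈ linkEdges X v l := by
    intro x hx
    refine List.mem_filterMap.2 ⟨n, hn, ?_⟩
    rw [← hx, ← ha, ← hb, ← hc]
  rcases hv with rfl | rfl | rfl
  · exact ⟨b, c, hbc, hab, hac, rfl, hmem _ (by simp)⟩
  · exact ⟨a, c, hac, hab.symm, hbc, Finset.insert_comm _ _ _, hmem _ (by simp [hab'])⟩
  · refine ⟨a, b, hab, hac.symm, hbc.symm, ?_, hmem _ (by simp [hac', hbc'])⟩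
    rw [Finset.insert_comm v, Finset.pair_comm v]

theorem isPolyhedralImmersion_realization {l : List ℕ} (h : isTriangleList l = true)
    {c : List (ℤ × ℤ × ℤ)} (hc : immersionCheck l c = true) :
    IsPolyhedralImmersion (triangleComplex l) (realization c) := by
  refine isPolyhedralImmersion_of_cones (exists_mem_facets h) fun v s hs t ht hvs hvt => ?_
  rw [immersionCheck, List.all_eq_true] at hc
  have hpair := pairwiseAll_iff (hc v (List.mem_range.2 v.2))
  set X : ℕ → ℤ × ℤ × ℤ := fun w => position c w - position c v with hX
  obtain ⟨i, j, hij, hvi, hvj, rfl, he⟩ := exists_linkEdge h X hs hvs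
  obtain ⟨k, m, hkm, hvk, hvm, rfl, hf⟩ := exists_linkEdge h X ht hvt
  intro x y hx hy hxs hyt hxy
  rw [sum_smul_sub_of_support hij hvi hvj _ hxs, sum_smul_sub_of_support hkm hvk hvm _ hyt] at hxy
  have hr : Relation (X i) (X j) (X k) (X m) (x i) (x j) (y k) (y m) := by
    refine ⟨?_, ?_, ?_⟩
    · simpa [realization, hX] using congrArg (fun z : EuclideanSpace ℝ (Fin 3) => z 0) hxy
    · simpa [realization, hX] using congrArg (fun z : EuclideanSpace ℝ (Fin 3) => z 1) hxy
    · simpa [realization, hX] using congrArg (fun z : EuclideanSpace ℝ (Fin 3) => z 2) hxy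
  have expand : ∀ {a b : Fin 10} {z : Fin 10 → ℝ}, a ≠ b →
      (∀ w, z w ≠ 0 → w ∈ ({v, a, b} : Finset (Fin 10))) → ∀ w, w ≠ v →
      z w = (if (w : ℕ) = a then z a else 0) + if (w : ℕ) = b then z b else 0 := by
    intro a b z hab hz w hw
    simp only [← Fin.ext_iff]
    split_ifs with h1 h2 h2
    · exact absurd (h1.symm.trans h2) hab
    · rw [h1, add_zero]
    · rw [h2, zero_add]
    · rw [add_zero]
      by_contra hn
      simpa [hw, h1, h2] using hz w hn
  intro w hw
  rw [expand hij hxs w hw, expand hkm hyt w hw]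
  rcases hpair _ he _ hf with h | h
  · exact eq_of_conesCheck h (hx _) (hx _) (hy _) (hy _) hr w
  · exact (eq_of_conesCheck h (hy _) (hy _) (hx _) (hx _) hr.symm w).symm

/-! ### Involutory symmetries -/

/-- The affine reflection of space in a linear subspace. -/
noncomputable def linearReflection (K : Submodule ℝ (EuclideanSpace ℝ (Fin 3))) :
    EuclideanSpace ℝ (Fin 3) ≃ᵃⁱ[ℝ] EuclideanSpace ℝ (Fin 3) :=
  haveI : Nonempty K.toAffineSubspace := ⟨⟨0, K.zero_mem⟩⟩
  EuclideanGeometry.reflection K.toAffineSubspace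

theorem linearReflection_apply (K : Submodule ℝ (EuclideanSpace ℝ (Fin 3)))
    (x : EuclideanSpace ℝ (Fin 3)) : linearReflection K x = K.reflection x := by
  have : Nonempty K.toAffineSubspace := ⟨⟨0, K.zero_mem⟩⟩
  have := EuclideanGeometry.reflection_apply_of_mem K.toAffineSubspace x (x := 0) K.zero_mem
  simpa [linearReflection] using this

/-- The third coordinate axis. -/
noncomputable def thirdAxis : Submodule ℝ (EuclideanSpace ℝ (Fin 3)) :=
  ℝ ∙ (EuclideanSpace.single 2 1 : EuclideanSpace ℝ (Fin 3))

theorem reflection_thirdAxis (x : EuclideanSpace ℝ (Fin 3)) :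
    thirdAxis.reflection x = !₂[-x 0, -x 1, x 2] := by
  unfold thirdAxis
  rw [Submodule.reflection_singleton_apply]
  ext i
  fin_cases i <;> simp [EuclideanSpace.inner_single_left]
  ring

theorem isTwofoldRotation_thirdAxis : IsTwofoldRotation (linearReflection thirdAxis) :=
  ⟨thirdAxis.toAffineSubspace, ⟨⟨0, thirdAxis.zero_mem⟩⟩,
    by
      rw [Submodule.toAffineSubspace_direction]
      exact finrank_span_singleton (by simp), rfl⟩

theorem isPlaneReflection_thirdAxis_orthogonal :
    IsPlaneReflection (linearReflection thirdAxisᗮ) := by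
  have : Fact (Module.finrank ℝ (EuclideanSpace ℝ (Fin 3)) = 2 + 1) := ⟨by simp⟩
  refine ⟨thirdAxisᗮ.toAffineSubspace, ⟨⟨0, thirdAxisᗮ.zero_mem⟩⟩, ?_, rfl⟩
  rw [Submodule.toAffineSubspace_direction]
  exact Submodule.finrank_orthogonal_span_singleton (by simp)

/-- The image of a triangle under a map of the vertices, which is given by the list of its
values. -/
def imageMask (g : List ℕ) (n : ℕ) : ℕ :=
  mask [g.getD (n / 100) 0, g.getD (n / 10 % 10) 0, g.getD (n % 10) 0]

/-- The list `g` describes an involution of the vertices which maps triangles to triangles. -/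
def involutionCheck (l g : List ℕ) : Bool :=
  (List.range 10).all (fun v => decide (g.getD v 0 < 10) && g.getD (g.getD v 0) 0 == v) &&
    (List.range 10).any (fun v => g.getD v 0 != v) &&
    l.all fun n => (l.map triangleMask).contains (imageMask g n)

/-- The involution `g` is realized by the half-turn about the third axis, or (if `r` is true) by the
reflection in the orthogonal plane, which is its negative. -/
def symmetryCheck (r : Bool) (g : List ℕ) (c : List (ℤ × ℤ × ℤ)) : Bool :=
  (List.range 10).all fun v =>
    let p := position c v
    position c (g.getD v 0) == if r then (p.1, p.2.1, -p.2.2) else (-p.1, -p.2.1, p.2.2)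

/-- The isometry of space checked by `symmetryCheck`. -/
noncomputable def symmetryIsometry (r : Bool) :
    EuclideanSpace ℝ (Fin 3) ≃ᵃⁱ[ℝ] EuclideanSpace ℝ (Fin 3) :=
  if r then linearReflection thirdAxisᗮ else linearReflection thirdAxis

theorem symmetryIsometry_sum (r : Bool) {ι : Type*} (s : Finset ι) (x : ι → ℝ)
    (p : ι → EuclideanSpace ℝ (Fin 3)) :
    symmetryIsometry r (∑ i ∈ s, x i • p i) = ∑ i ∈ s, x i • symmetryIsometry r (p i) := by
  cases r <;> simp [symmetryIsometry, linearReflection_apply]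

theorem symmetryIsometry_apply (r : Bool) (x : EuclideanSpace ℝ (Fin 3)) :
    symmetryIsometry r x = if r then !₂[x 0, x 1, -x 2] else !₂[-x 0, -x 1, x 2] := by
  cases r
  · simp [symmetryIsometry, linearReflection_apply, reflection_thirdAxis]
  · rw [symmetryIsometry, if_pos rfl, linearReflection_apply,
      Submodule.reflection_orthogonal_apply, reflection_thirdAxis, if_pos rfl]
    ext i
    fin_cases i <;> simp

theorem isInvolutorySymmetry_realization {l g : List ℕ} (h : isTriangleList l = true)
    (hg : involutionCheck l g = true) {r : Bool} {c : List (ℤ × ℤ × ℤ)}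
    (hc : symmetryCheck r g c = true) :
    IsInvolutorySymmetry (triangleComplex l) (realization c) (symmetryIsometry r) := by
  simp only [involutionCheck, Bool.and_eq_true, List.all_eq_true, List.any_eq_true,
    List.mem_range, decide_eq_true_eq, beq_iff_eq, bne_iff_ne, List.contains_iff_mem] at hg
  obtain ⟨⟨hinv, w, hw, hgw⟩, hl⟩ := hg
  let γ : Fin 10 → Fin 10 := fun v => ⟨g.getD v 0, (hinv v v.2).1⟩
  have hγ : Function.Involutive γ := fun v => Fin.ext (hinv v v.2).2
  have hfacet : ∀ t ∈ facets (l.map triangleMask),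
      t.map (hγ.toPerm γ).toEmbedding ∈ facets (l.map triangleMask) := by
    rintro _ ⟨m, hm, rfl⟩
    obtain ⟨n, hn, rfl⟩ := List.mem_map.1 hm
    refine ⟨imageMask g n, hl n hn, ?_⟩
    obtain ⟨a, b, d, ha, hb, hd, -, -, -, e⟩ := exists_triangle_eq (isTriangle_of_mem h hn)
    rw [e, imageMask, ha, hb, hd]
    simp only [Finset.map_insert, Finset.map_singleton]
    exact (vertexSet_mask_three (γ a) (γ b) (γ d)).symm
  have hface : ∀ s ∈ (triangleComplex l).faces,
      s.map (hγ.toPerm γ).toEmbedding ∈ (triangleComplex l).faces := by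
    intro s hs
    obtain ⟨hne, t, ht, hst⟩ := (mem_facetComplex (exists_mem_facets h)).1 hs
    exact (mem_facetComplex (exists_mem_facets h)).2
      ⟨hne.map, _, hfacet t ht, Finset.map_subset_map.2 hst⟩
  have hmap : ∀ s : Finset (Fin 10),
      (s.map (hγ.toPerm γ).toEmbedding).map (hγ.toPerm γ).toEmbedding = s := by
    intro s
    rw [Finset.map_map]
    convert Finset.map_refl
    ext v
    simp [hγ v]
  refine ⟨⟨hγ.toPerm γ, fun s => ⟨fun hs => hmap s ▸ hface _ hs, hface s⟩⟩, ?_, fun x => ?_⟩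
  · refine orderOf_eq_prime ?_ fun h1 => hgw ?_
    · rw [sq]
      exact Equiv.ext fun v => hγ v
    · exact congrArg Fin.val (Equiv.congr_fun h1 ⟨w, hw⟩)
  · have hψ : ∀ v, symmetryIsometry r (realization c v) = realization c (γ v) := by
      intro v
      have hv : position c (g.getD v 0) = _ :=
        beq_iff_eq.1 (List.all_eq_true.1 hc v (List.mem_range.2 v.2))
      rw [symmetryIsometry_apply, realization, realization, show ((γ v : Fin 10) : ℕ) =
        g.getD v 0 from rfl, hv]
      cases r <;> simp
    rw [simplexwiseLinearMap, symmetryIsometry_sum, simplexwiseLinearMap]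
    refine (Finset.sum_congr rfl fun v _ => ?_).trans (Equiv.sum_comp (hγ.toPerm γ) _)
    change _ = x.1 ((hγ.toPerm γ).symm (hγ.toPerm γ v)) • realization c (γ v)
    rw [hψ, Equiv.symm_apply_apply]

/-! ### The triangulations -/

/-- A triangulation with ten vertices, together with a sequence of flips which leads to it from the
base triangulation of the Klein bottle, an involution of the vertices, and their positions in
space. -/
structure SymmetricSurface where
  /-- the codes of the triangles -/
  triangles : List ℕ
  /-- the codes of the flips -/
  flips : List ℕ
  /-- the values of the involution -/
  involution : List ℕ
  /-- the positions of the vertices -/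
  positions : List (ℤ × ℤ × ℤ)

/-- The surface is a Klein bottle, immersed with the given symmetry (a reflection if `r` is
true). -/
def SymmetricSurface.check (r : Bool) (s : SymmetricSurface) : Bool :=
  isTriangleList s.triangles &&
    flipsTo (s.triangles.map triangleMask) s.flips baseMasks &&
    involutionCheck s.triangles s.involution &&
    immersionCheck s.triangles s.positions &&
    symmetryCheck r s.involution s.positions

/-- Nine triangulations which are immersed with a reflection as a symmetry. -/
def mirrorData : List SymmetricSurface := [
  { triangles := [12, 14, 23, 34, 129, 145, 157, 178, 189, 235, 257, 267, 269, 347, 356, 367, 458, 478, 568,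
      689]
    flips := [629, 819, 1257, 912]
    involution := [0, 2, 1, 4, 3, 5, 8, 7, 6, 9]
    positions := [(10, -15, 0), (-8, 0, -1), (-8, 0, 1), (3, 8, 10), (3, 8, -10), (-8, -15, 0),
      (-15, -11, 15), (-15, 12, 0), (-15, -11, -15), (-2, 9, 0)] },
  { triangles := [12, 14, 23, 37, 47, 129, 145, 157, 178, 189, 235, 257, 267, 269, 356, 367, 458, 478, 568,
      689]
    flips := [629, 819, 1257, 912, 3407]
    involution := [0, 2, 1, 4, 3, 5, 8, 7, 6, 9]
    positions := [(-11, -12, 0), (-6, 13, -8), (-6, 13, 8), (-15, -13, 15), (-15, -13, -15), (13, 14, 0),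
      (-3, 15, 15), (-12, 13, 0), (-3, 15, -15), (-13, 8, 0)] },
  { triangles := [14, 18, 23, 26, 34, 69, 89, 125, 127, 145, 178, 235, 267, 347, 356, 367, 458, 478, 568, 689]
    flips := []
    involution := [0, 2, 1, 4, 3, 5, 8, 7, 6, 9]
    positions := [(-9, -15, 0), (9, -13, 1), (9, -13, -1), (4, 9, -3), (4, 9, 3), (7, 3, 0), (12, 1, -7),
      (14, 6, 0), (12, 1, 7), (-12, -15, 0)] },
  { triangles := [14, 18, 23, 26, 34, 69, 89, 145, 157, 178, 235, 257, 267, 347, 356, 367, 458, 478, 568, 689]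
    flips := [1257]
    involution := [0, 2, 1, 4, 3, 5, 8, 7, 6, 9]
    positions := [(-7, 10, 0), (22, 25, 12), (22, 25, -12), (17, -17, -16), (17, -17, 16), (25, 22, 0),
      (25, 25, -25), (-18, 9, 0), (25, 25, 25), (-8, -21, 0)] },
  { triangles := [14, 18, 23, 26, 37, 47, 69, 89, 125, 127, 145, 178, 235, 267, 356, 367, 458, 478, 568, 689]
    flips := [3407]
    involution := [0, 2, 1, 4, 3, 5, 8, 7, 6, 9]
    positions := [(-15, -4, 0), (-4, -15, 15), (-4, -15, -15), (2, 9, -4), (2, 9, 4), (0, 2, 0),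
      (3, -3, -13), (15, 15, 0), (3, -3, 13), (-15, 8, 0)] },
  { triangles := [14, 19, 23, 29, 34, 125, 127, 145, 178, 189, 235, 267, 269, 347, 356, 367, 458, 478, 568,
      689]
    flips := [629, 819]
    involution := [0, 2, 1, 4, 3, 5, 8, 7, 6, 9]
    positions := [(-11, -12, 0), (-13, -2, -6), (-13, -2, 6), (-15, 7, 13), (-15, 7, -13), (-1, 13, 0),
      (-15, -15, 4), (-13, -3, 0), (-15, -15, -4), (-11, -1, 0)] },
  { triangles := [14, 19, 23, 29, 34, 145, 157, 178, 189, 235, 257, 267, 269, 347, 356, 367, 458, 478, 568,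
      689]
    flips := [629, 819, 1257]
    involution := [0, 2, 1, 4, 3, 5, 8, 7, 6, 9]
    positions := [(-4, 4, 0), (-15, -4, 2), (-15, -4, -2), (-1, 14, -11), (-1, 14, 11), (-14, 9, 0),
      (-15, 5, -14), (1, -2, 0), (-15, 5, 14), (12, 15, 0)] },
  { triangles := [14, 19, 23, 29, 37, 47, 125, 127, 145, 178, 189, 235, 267, 269, 356, 367, 458, 478, 568,
      689]
    flips := [629, 819, 3407]
    involution := [0, 2, 1, 4, 3, 5, 8, 7, 6, 9]
    positions := [(-9, 15, 0), (15, 15, -8), (15, 15, 8), (9, 7, 4), (9, 7, -4), (12, 9, 0), (14, 11, 15),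
      (15, -5, 0), (14, 11, -15), (-15, 13, 0)] },
  { triangles := [15, 18, 27, 29, 45, 47, 89, 125, 126, 167, 178, 235, 237, 269, 356, 367, 458, 478, 568, 689]
    flips := [629, 1405, 2716, 3407, 327]
    involution := [2, 1, 0, 4, 3, 5, 8, 7, 6, 9]
    positions := [(-7, 0, -2), (-6, 10, 0), (-7, 0, 2), (15, -5, 10), (15, -5, -10), (-6, 1, 0), (-4, 8, 6),
      (9, -1, 0), (-4, 8, -6), (-12, -15, 0)] }]

/-- Sixty-seven triangulations which are immersed with a half-turn as a symmetry. -/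
def halfTurnData : List SymmetricSurface := [
  { triangles := [14, 18, 23, 26, 34, 69, 89, 125, 128, 145, 235, 267, 278, 346, 356, 458, 467, 478, 569, 589]
    flips := [1728, 3746, 6859]
    involution := [4, 3, 5, 1, 0, 2, 8, 9, 6, 7]
    positions := [(-5, -6, 8), (-7, -7, 13), (2, 7, -9), (7, 7, 13), (5, 6, 8), (-2, -7, -9), (4, 13, -13),
      (3, 10, -10), (-4, -13, -13), (-3, -10, -10)] },
  { triangles := [14, 18, 23, 29, 36, 47, 67, 89, 125, 127, 145, 178, 235, 267, 269, 356, 457, 569, 578, 589]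
    flips := [629, 3407, 3706, 4857, 6859]
    involution := [5, 6, 7, 4, 3, 0, 1, 2, 9, 8]
    positions := [(-13, -1, -9), (-11, -11, 11), (1, -5, 0), (14, -13, 13), (-14, 13, 13), (13, 1, -9),
      (11, 11, 11), (-1, 5, 0), (9, -6, -12), (-9, 6, -12)] },
  { triangles := [14, 18, 24, 29, 58, 59, 125, 126, 136, 137, 145, 178, 234, 235, 269, 347, 356, 458, 478,
      569]
    flips := [324, 629, 2716, 6713, 6859, 8905]
    involution := [3, 5, 4, 0, 2, 1, 8, 9, 6, 7]
    positions := [(0, -3, -1), (11, 11, 11), (-11, 8, -2), (0, 3, -1), (11, -8, -2), (-11, -11, 11),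
      (14, 11, 6), (-6, -1, -8), (-14, -11, 6), (6, 1, -8)] },
  { triangles := [12, 14, 23, 37, 47, 129, 145, 157, 178, 189, 235, 257, 267, 269, 356, 367, 458, 478, 569,
      589]
    flips := [629, 819, 1257, 912, 3407, 6859]
    involution := [9, 2, 1, 8, 6, 7, 4, 5, 3, 0]
    positions := [(-2, -13, 0), (-11, 7, 6), (11, -7, 6), (-11, 13, -15), (-3, -14, -12), (0, 5, -12),
      (3, 14, -12), (0, -5, -12), (11, -13, -15), (2, 13, 0)] },
  { triangles := [14, 17, 24, 29, 78, 89, 148, 157, 158, 234, 235, 257, 267, 269, 347, 356, 367, 478, 568,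
      689]
    flips := [324, 629, 1257, 1807, 4518]
    involution := [6, 3, 8, 1, 5, 4, 0, 7, 2, 9]
    positions := [(11, -11, 15), (-9, 8, -14), (7, 15, -13), (9, -8, -14), (12, 5, -5), (-12, -5, -5),
      (-11, 11, 15), (0, 0, -2), (-7, -15, -13), (0, 0, 2)] },
  { triangles := [14, 17, 34, 38, 78, 145, 157, 235, 239, 257, 267, 269, 347, 356, 367, 389, 458, 478, 568,
      689]
    flips := [629, 239, 938, 1257, 1807]
    involution := [2, 9, 0, 7, 6, 8, 4, 3, 5, 1]
    positions := [(10, -11, 7), (-6, -15, 15), (-10, 11, 7), (-10, -15, -9), (-14, -1, 2), (6, 6, -4),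
      (14, 1, 2), (10, 15, -9), (-6, -6, -4), (6, 15, 15)] },
  { triangles := [14, 17, 34, 39, 78, 89, 125, 127, 145, 235, 239, 267, 269, 347, 356, 367, 458, 478, 568,
      689]
    flips := [629, 239, 1807]
    involution := [2, 9, 0, 7, 6, 8, 4, 3, 5, 1]
    positions := [(-6, 11, -14), (-12, 10, -12), (6, -11, -14), (4, -4, -11), (0, -15, -12), (-7, 8, 15),
      (0, 15, -12), (-4, 4, -11), (7, -8, 15), (12, -10, -12)] },
  { triangles := [14, 18, 23, 26, 34, 69, 89, 125, 127, 145, 178, 235, 267, 347, 356, 367, 458, 478, 569, 589]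
    flips := [6859]
    involution := [5, 3, 4, 1, 2, 0, 8, 7, 6, 9]
    positions := [(-4, -15, -15), (10, 14, -10), (-4, -7, -3), (-10, -14, -10), (4, 7, -3), (4, 15, -15),
      (10, 5, -12), (0, 0, -9), (-10, -5, -12), (0, 0, -15)] },
  { triangles := [14, 18, 23, 26, 37, 47, 69, 89, 145, 157, 178, 235, 257, 267, 356, 367, 458, 478, 569, 589]
    flips := [1257, 3407, 6859]
    involution := [5, 3, 4, 1, 2, 0, 8, 7, 6, 9]
    positions := [(-5, 15, -5), (11, 1, -15), (15, -11, -13), (-11, -1, -15), (-15, 11, -13), (5, -15, -5),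
      (-12, 0, 12), (0, 0, -5), (12, 0, 12), (0, 0, 10)] },
  { triangles := [14, 18, 23, 28, 34, 125, 127, 145, 178, 235, 267, 269, 289, 347, 356, 367, 456, 469, 478,
      489]
    flips := [629, 928, 5846, 6849]
    involution := [5, 3, 4, 1, 2, 0, 8, 7, 6, 9]
    positions := [(-10, -12, 12), (4, 0, 12), (-9, -5, -10), (-4, 0, 12), (9, 5, -10), (10, 12, 12),
      (9, -1, 15), (0, 0, 12), (-9, 1, 15), (0, 0, -15)] },
  { triangles := [14, 18, 23, 29, 34, 89, 125, 127, 145, 178, 235, 267, 269, 347, 356, 367, 459, 478, 489,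
      569]
    flips := [629, 6859, 5849]
    involution := [3, 5, 4, 0, 2, 1, 8, 9, 6, 7]
    positions := [(2, 4, 7), (15, -4, -15), (-10, -13, 13), (-2, -4, 7), (10, 13, 13), (-15, 4, -15),
      (14, -8, 9), (-3, -9, 9), (-14, 8, 9), (3, 9, 9)] },
  { triangles := [14, 18, 23, 29, 36, 47, 58, 59, 67, 125, 127, 145, 178, 235, 267, 269, 356, 457, 569, 578]
    flips := [629, 3407, 3706, 4857, 6859, 8905]
    involution := [5, 6, 7, 4, 3, 0, 1, 2, 9, 8]
    positions := [(-11, -7, -3), (15, -1, 12), (13, 1, 15), (-15, -13, -12), (15, 13, -12), (11, 7, -3),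
      (-15, 1, 12), (-13, -1, 15), (8, 5, 6), (-8, -5, 6)] },
  { triangles := [14, 18, 24, 26, 56, 59, 89, 149, 157, 159, 178, 234, 235, 257, 267, 347, 356, 367, 478, 489]
    flips := [324, 1257, 6859, 5849, 4519, 6905]
    involution := [5, 2, 1, 8, 7, 0, 9, 4, 3, 6]
    positions := [(4, 3, -10), (15, 15, 12), (-15, -15, 12), (-4, -3, -14), (14, 11, -15), (-4, -3, -10),
      (-12, 0, 10), (-14, -11, -15), (4, 3, -14), (12, 0, 10)] },
  { triangles := [14, 18, 24, 26, 69, 89, 125, 126, 145, 167, 178, 234, 235, 348, 356, 367, 378, 458, 569,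
      589]
    flips := [324, 2716, 4738, 6859]
    involution := [3, 5, 4, 0, 2, 1, 8, 9, 6, 7]
    positions := [(-10, 15, 5), (-15, 15, 13), (12, -15, 11), (10, -15, 5), (-12, 15, 11), (15, -15, 13),
      (9, -9, 11), (9, 9, -5), (-9, 9, 11), (-9, -9, -5)] },
  { triangles := [14, 18, 24, 26, 69, 89, 125, 127, 145, 178, 234, 235, 267, 348, 356, 367, 378, 459, 489,
      569]
    flips := [324, 4738, 6859, 5849]
    involution := [3, 5, 4, 0, 2, 1, 8, 9, 6, 7]
    positions := [(-12, 13, -8), (3, 9, 11), (-2, -8, -12), (12, -13, -8), (2, 8, -12), (-3, -9, 11),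
      (12, 3, 15), (8, 2, 11), (-12, -3, 15), (-8, -2, 11)] },
  { triangles := [14, 18, 24, 26, 69, 89, 149, 157, 159, 178, 234, 235, 257, 267, 347, 356, 367, 478, 489,
      569]
    flips := [324, 1257, 6859, 5849, 4519]
    involution := [5, 2, 1, 8, 7, 0, 9, 4, 3, 6]
    positions := [(11, -5, 11), (-3, 15, 0), (3, -15, 0), (-15, 1, 15), (2, -14, 15), (-11, 5, 11),
      (15, -7, 12), (-2, 14, 15), (15, -1, 15), (-15, 7, 12)] },
  { triangles := [14, 18, 24, 26, 69, 89, 149, 157, 159, 178, 234, 235, 257, 267, 348, 356, 367, 378, 489,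
      569]
    flips := [324, 1257, 4738, 6859, 5849, 4519]
    involution := [6, 3, 9, 1, 5, 4, 0, 8, 7, 2]
    positions := [(-15, -14, -14), (-6, -6, -2), (2, -11, 7), (6, 6, -2), (4, -14, 10), (-4, 14, 10),
      (15, 14, -14), (-10, -6, -5), (10, 6, -5), (-2, 11, 7)] },
  { triangles := [14, 18, 24, 27, 67, 69, 89, 145, 157, 178, 234, 235, 257, 347, 356, 367, 459, 478, 489, 569]
    flips := [324, 1257, 2607, 6859, 5849]
    involution := [5, 2, 1, 8, 7, 0, 9, 4, 3, 6]
    positions := [(-1, -3, 9), (2, 7, 15), (-2, -7, 15), (-14, 12, -7), (-11, 6, -10), (1, 3, 9),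
      (-2, -2, 4), (11, -6, -10), (14, -12, -7), (2, 2, 4)] },
  { triangles := [14, 18, 24, 29, 89, 125, 126, 145, 167, 178, 234, 235, 269, 347, 356, 367, 458, 478, 569,
      589]
    flips := [324, 629, 2716, 6859]
    involution := [3, 5, 4, 0, 2, 1, 8, 9, 6, 7]
    positions := [(-11, -15, 6), (-6, 6, 10), (15, -10, -13), (11, 15, 6), (-15, 10, -13), (6, -6, 10),
      (-15, 13, 15), (-11, 14, 1), (15, -13, 15), (11, -14, 1)] },
  { triangles := [14, 18, 24, 29, 89, 125, 127, 145, 178, 234, 235, 267, 269, 347, 356, 367, 459, 478, 489,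
      569]
    flips := [324, 629, 6859, 5849]
    involution := [3, 5, 4, 0, 2, 1, 8, 9, 6, 7]
    positions := [(15, -11, 15), (-9, 7, 14), (-1, -11, -12), (-15, 11, 15), (1, 11, -12), (9, -7, 14),
      (15, -2, 15), (-3, 6, -3), (-15, 2, 15), (3, -6, -3)] },
  { triangles := [14, 18, 26, 27, 36, 39, 47, 89, 125, 127, 145, 178, 235, 239, 269, 356, 458, 478, 568, 689]
    flips := [629, 239, 3407, 3706, 6702]
    involution := [0, 6, 8, 4, 3, 5, 1, 9, 2, 7]
    positions := [(0, 0, -1), (14, -10, -14), (5, -3, -8), (15, 7, 8), (-15, -7, 8), (0, 0, 11),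
      (-14, 10, -14), (15, 5, -6), (-5, 3, -8), (-15, -5, -6)] },
  { triangles := [14, 18, 34, 35, 59, 89, 125, 128, 145, 259, 267, 269, 278, 347, 356, 367, 458, 478, 568,
      689]
    flips := [629, 1728, 2305, 259]
    involution := [2, 9, 0, 7, 6, 8, 4, 3, 5, 1]
    positions := [(-6, 8, -7), (15, -15, -15), (6, -8, -7), (-2, 3, 1), (5, 15, -1), (10, 4, 14),
      (-5, -15, -1), (2, -3, 1), (-10, -4, 14), (-15, 15, -15)] },
  { triangles := [14, 18, 34, 38, 123, 128, 135, 145, 239, 267, 269, 278, 347, 356, 367, 389, 458, 478, 568,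
      689]
    flips := [629, 239, 938, 1728, 2513]
    involution := [9, 2, 1, 8, 6, 7, 4, 5, 3, 0]
    positions := [(-15, -15, -15), (6, 3, -8), (-6, -3, -8), (-10, 1, 9), (-3, 15, -14), (12, 8, -10),
      (3, -15, -14), (-12, -8, -10), (10, -1, 9), (15, 15, -15)] },
  { triangles := [14, 18, 34, 38, 125, 127, 145, 178, 235, 239, 267, 269, 347, 356, 367, 389, 458, 478, 568,
      689]
    flips := [629, 239, 938]
    involution := [9, 2, 1, 8, 6, 7, 4, 5, 3, 0]
    positions := [(-12, 8, -15), (-3, -6, 1), (3, 6, 1), (-12, -15, 7), (0, -2, -13), (-1, 6, -8),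
      (0, 2, -13), (1, -6, -8), (12, 15, 7), (12, -8, -15)] },
  { triangles := [14, 18, 34, 39, 89, 125, 127, 145, 178, 235, 239, 267, 269, 347, 356, 367, 458, 478, 568,
      689]
    flips := [629, 239]
    involution := [9, 2, 1, 8, 6, 7, 4, 5, 3, 0]
    positions := [(-15, -13, -15), (-2, -2, -5), (2, 2, -5), (-8, -8, -12), (8, -2, 10), (-15, 6, -15),
      (-8, 2, 10), (15, -6, -15), (8, 8, -12), (15, 13, -15)] },
  { triangles := [14, 18, 37, 38, 47, 125, 127, 145, 178, 235, 239, 267, 269, 356, 367, 389, 458, 478, 569,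
      589]
    flips := [629, 239, 938, 3407, 6859]
    involution := [9, 2, 1, 8, 6, 7, 4, 5, 3, 0]
    positions := [(6, -15, 5), (-1, 12, -3), (1, -12, -3), (15, -15, 8), (0, 15, -15), (-1, 14, -13),
      (0, -15, -15), (1, -14, -13), (-15, 15, 8), (-6, 15, 5)] },
  { triangles := [14, 18, 37, 38, 47, 145, 157, 178, 235, 239, 257, 267, 269, 356, 367, 389, 458, 478, 569,
      589]
    flips := [629, 239, 938, 1257, 3407, 6859]
    involution := [9, 2, 1, 8, 6, 7, 4, 5, 3, 0]
    positions := [(11, -10, 6), (-11, -9, -15), (11, 9, -15), (15, 6, 15), (15, 15, -15), (-14, -5, 2),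
      (-15, -15, -15), (14, 5, 2), (-15, -6, 15), (-11, 10, 6)] },
  { triangles := [14, 18, 37, 39, 47, 89, 125, 127, 145, 178, 235, 239, 267, 269, 356, 367, 458, 478, 569,
      589]
    flips := [629, 239, 3407, 6859]
    involution := [9, 2, 1, 8, 6, 7, 4, 5, 3, 0]
    positions := [(-4, 3, -4), (-14, 2, -15), (14, -2, -15), (1, 9, 12), (-11, 13, -5), (15, -9, -11),
      (11, -13, -5), (-15, 9, -11), (-1, -9, 12), (4, -3, -4)] },
  { triangles := [14, 18, 37, 39, 47, 89, 145, 157, 178, 235, 239, 257, 267, 269, 356, 367, 458, 478, 569,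
      589]
    flips := [629, 239, 1257, 3407, 6859]
    involution := [9, 2, 1, 8, 6, 7, 4, 5, 3, 0]
    positions := [(5, 0, -10), (8, -10, 13), (-8, 10, 13), (6, 1, 12), (-12, 0, -15), (-2, -8, 14),
      (12, 0, -15), (2, 8, 14), (-6, -1, 12), (-5, 0, -10)] },
  { triangles := [14, 18, 47, 58, 59, 79, 125, 127, 145, 178, 235, 239, 267, 269, 356, 367, 379, 458, 478,
      569]
    flips := [629, 239, 3407, 379, 6859, 8905]
    involution := [2, 9, 0, 8, 6, 5, 4, 7, 3, 1]
    positions := [(-4, -13, 8), (-9, 12, 10), (4, 13, 8), (-7, -15, 8), (12, 2, -6), (0, 0, 6),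
      (-12, -2, -6), (0, 0, -12), (7, 15, 8), (9, -12, 10)] },
  { triangles := [14, 18, 47, 58, 59, 79, 145, 157, 178, 235, 239, 257, 267, 269, 356, 367, 379, 458, 478,
      569]
    flips := [629, 239, 1257, 3407, 379, 6859, 8905]
    involution := [9, 2, 1, 8, 6, 7, 4, 5, 3, 0]
    positions := [(11, -9, -10), (9, -1, -7), (-9, 1, -7), (13, -8, -9), (-1, -15, 11), (5, 8, -7),
      (1, 15, 11), (-5, -8, -7), (-13, 8, -9), (-11, 9, -10)] },
  { triangles := [14, 19, 23, 29, 37, 47, 145, 157, 178, 189, 235, 257, 267, 269, 356, 367, 458, 478, 569,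
      589]
    flips := [629, 819, 1257, 3407, 6859]
    involution := [9, 2, 1, 8, 6, 7, 4, 5, 3, 0]
    positions := [(9, 15, 14), (3, -15, 15), (-3, 15, 15), (-1, 11, -9), (-9, 8, -1), (0, -9, 1),
      (9, -8, -1), (0, 9, 1), (1, -11, -9), (-9, -15, 14)] },
  { triangles := [15, 18, 23, 29, 34, 45, 89, 125, 127, 178, 235, 246, 247, 269, 346, 358, 368, 458, 478, 689]
    flips := [629, 1405, 3746, 5638, 6724]
    involution := [4, 6, 8, 5, 0, 3, 1, 9, 2, 7]
    positions := [(1, 4, 11), (-14, 10, -15), (-15, 8, 15), (15, -15, 15), (-1, -4, 11), (-15, 15, 15),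
      (14, -10, -15), (-15, -15, 13), (15, -8, 15), (15, 15, 13)] },
  { triangles := [15, 18, 23, 29, 34, 45, 89, 125, 127, 178, 238, 246, 247, 258, 269, 346, 368, 458, 478, 689]
    flips := [629, 1405, 3746, 5638, 3528, 6724]
    involution := [4, 6, 8, 5, 0, 3, 1, 9, 2, 7]
    positions := [(-2, -3, 0), (1, -10, 14), (11, -8, -12), (-13, 15, -14), (2, 3, 0), (13, -15, -14),
      (-1, 10, 14), (12, 15, 7), (-11, 8, -12), (-12, -15, 7)] },
  { triangles := [15, 19, 46, 48, 58, 69, 125, 127, 134, 137, 148, 189, 234, 235, 246, 267, 356, 367, 568,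
      689]
    flips := [324, 246, 819, 1405, 4508, 7814, 4713]
    involution := [3, 6, 8, 0, 4, 5, 1, 9, 2, 7]
    positions := [(15, 8, 15), (-15, 4, 8), (3, -1, -9), (-15, -8, 15), (0, 0, -15), (0, 0, 4), (15, -4, 8),
      (-11, 5, 9), (-3, 1, -9), (11, -5, 9)] },
  { triangles := [15, 19, 46, 48, 58, 69, 125, 127, 147, 148, 189, 234, 235, 246, 267, 347, 357, 567, 568,
      689]
    flips := [324, 246, 819, 1405, 3657, 4508, 7814]
    involution := [2, 5, 0, 9, 6, 1, 4, 8, 7, 3]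
    positions := [(1, 13, 15), (1, -11, 3), (-1, -13, 15), (-6, 6, 11), (0, -7, -8), (-1, 11, 3), (0, 7, -8),
      (0, 15, -10), (0, -15, -10), (6, -6, 11)] },
  { triangles := [15, 19, 46, 48, 58, 69, 125, 127, 178, 189, 234, 235, 246, 267, 347, 357, 478, 567, 568,
      689]
    flips := [324, 246, 819, 1405, 3657, 4508]
    involution := [2, 4, 0, 9, 1, 6, 5, 8, 7, 3]
    positions := [(-15, -12, -13), (-14, 15, -14), (15, 12, -13), (12, -11, -5), (14, -15, -14), (-4, 2, -8),
      (4, -2, -8), (2, -15, -15), (-2, 15, -15), (-12, 11, -5)] },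
  { triangles := [23, 26, 37, 45, 47, 58, 69, 89, 125, 127, 157, 235, 267, 356, 367, 456, 468, 478, 578, 689]
    flips := [1405, 3407, 5846, 158, 1857]
    involution := [7, 9, 8, 4, 3, 6, 5, 0, 2, 1]
    positions := [(0, 15, 13), (-1, -1, -14), (-10, 13, -15), (11, -5, -10), (-11, 5, -10), (-1, -1, 0),
      (1, 1, 0), (0, -15, 13), (10, -13, -15), (1, 1, -14)] },
  { triangles := [24, 26, 45, 58, 69, 89, 125, 127, 157, 234, 235, 267, 348, 356, 367, 378, 456, 468, 578,
      689]
    flips := [324, 1405, 4738, 5846, 158, 1857]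
    involution := [7, 9, 8, 4, 3, 6, 5, 0, 2, 1]
    positions := [(-4, 15, 15), (7, -3, -6), (-12, -3, -13), (9, 14, -11), (-9, -14, -11), (5, -2, 3),
      (-5, 2, 3), (4, -15, 15), (12, 3, -13), (-7, 3, -6)] },
  { triangles := [24, 26, 45, 58, 69, 89, 125, 127, 157, 235, 238, 248, 267, 356, 367, 378, 456, 468, 578,
      689]
    flips := [324, 1405, 4738, 3428, 5846, 158, 1857]
    involution := [7, 9, 8, 4, 3, 6, 5, 0, 2, 1]
    positions := [(-9, 5, 10), (15, -11, -9), (-11, -7, -13), (0, 15, -15), (0, -15, -15), (6, -3, -1),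
      (-6, 3, -1), (9, -5, 10), (11, 7, -13), (-15, 11, -9)] },
  { triangles := [24, 27, 49, 67, 69, 125, 127, 145, 149, 179, 234, 235, 347, 356, 367, 458, 478, 568, 689,
      789]
    flips := [324, 819, 149, 1879, 2607]
    involution := [1, 0, 9, 8, 7, 6, 5, 4, 3, 2]
    positions := [(-13, -15, 14), (13, 15, 14), (-9, -10, 15), (-14, 5, -11), (-12, 3, -11), (-1, 3, -2),
      (1, -3, -2), (12, -3, -11), (14, -5, -11), (9, 10, 15)] },
  { triangles := [23, 29, 34, 45, 58, 89, 125, 127, 158, 178, 238, 245, 248, 267, 269, 347, 367, 368, 478,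
      689]
    flips := [629, 1405, 5638, 3528, 5824, 158]
    involution := [7, 9, 8, 4, 3, 6, 5, 0, 2, 1]
    positions := [(6, 5, -13), (23, -4, -20), (-21, 18, 24), (14, 14, 14), (-14, -14, 14), (8, -2, 14),
      (-8, 2, 14), (-6, -5, -13), (21, -18, 24), (-23, 4, -20)] },
  { triangles := [13, 14, 34, 124, 126, 138, 167, 178, 235, 238, 245, 269, 289, 347, 356, 367, 458, 478, 568,
      689]
    flips := [629, 928, 238, 813, 1524, 2716]
    involution := [9, 2, 1, 8, 6, 7, 4, 5, 3, 0]
    positions := [(-25, -19, -8), (-25, -16, 25), (25, 16, 25), (17, 13, 2), (21, -24, -5), (-25, -13, 5),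
      (-21, 24, -5), (25, 13, 5), (-17, -13, 2), (25, 19, -8)] },
  { triangles := [13, 14, 34, 125, 127, 138, 145, 178, 235, 238, 267, 269, 289, 347, 356, 367, 458, 478, 568,
      689]
    flips := [629, 928, 238, 813]
    involution := [9, 2, 1, 8, 6, 7, 4, 5, 3, 0]
    positions := [(18, -13, 25), (25, 25, 6), (-25, -25, 6), (7, -21, -25), (-23, -18, 7), (4, 11, -9),
      (23, 18, 7), (-4, -11, -9), (-7, 21, -25), (-18, 13, 25)] },
  { triangles := [14, 17, 46, 69, 78, 89, 125, 127, 145, 234, 235, 246, 267, 347, 358, 379, 389, 458, 478,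
      679]
    flips := [324, 246, 1807, 5638, 6839, 3679]
    involution := [2, 6, 0, 8, 7, 9, 1, 4, 3, 5]
    positions := [(-17, -9, 11), (1, 21, -25), (17, 9, 11), (15, 17, 14), (-24, -9, 20), (-22, -25, -25),
      (-1, -21, -25), (24, 9, 20), (-15, -17, 14), (22, 25, -25)] },
  { triangles := [14, 18, 23, 26, 34, 69, 89, 125, 128, 145, 235, 267, 278, 348, 356, 367, 378, 456, 469, 489]
    flips := [1728, 4738, 5846, 6849]
    involution := [3, 5, 4, 0, 2, 1, 8, 9, 6, 7]
    positions := [(-5, 19, -23), (-25, -7, 8), (4, -11, -7), (5, -19, -23), (-4, 11, -7), (25, 7, 8),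
      (-6, 23, -25), (-25, 23, 3), (6, -23, -25), (25, -23, 3)] },
  { triangles := [14, 18, 23, 26, 34, 69, 89, 145, 157, 178, 238, 245, 248, 257, 267, 347, 367, 369, 389, 478]
    flips := [1257, 5638, 3528, 5824, 6839]
    involution := [7, 6, 8, 4, 3, 9, 1, 0, 2, 5]
    positions := [(-18, 12, -6), (-23, -12, -18), (6, 2, -17), (25, -25, 1), (-25, 25, 1), (1, -6, -25),
      (23, 12, -18), (18, -12, -6), (-6, -2, -17), (-1, 6, -25)] },
  { triangles := [14, 18, 24, 26, 69, 89, 125, 128, 145, 234, 235, 267, 278, 348, 356, 367, 378, 456, 469,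
      489]
    flips := [324, 1728, 4738, 5846, 6849]
    involution := [3, 5, 4, 0, 2, 1, 8, 9, 6, 7]
    positions := [(-25, 13, 21), (3, -2, 1), (17, 10, -25), (25, -13, 21), (-17, -10, -25), (-3, 2, 1),
      (15, 14, -3), (-25, 3, 15), (-15, -14, -3), (25, -3, 15)] },
  { triangles := [14, 18, 24, 27, 56, 59, 67, 89, 145, 157, 178, 234, 235, 257, 347, 356, 367, 459, 478, 489]
    flips := [324, 1257, 2607, 6859, 5849, 6905]
    involution := [5, 2, 1, 8, 7, 0, 9, 4, 3, 6]
    positions := [(7, -5, -7), (-6, 22, -25), (6, -22, -25), (-25, -20, 24), (-19, -19, 22), (-7, 5, -7),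
      (15, -14, -2), (19, 19, 22), (25, 20, 24), (-15, 14, -2)] },
  { triangles := [14, 18, 34, 35, 59, 89, 125, 128, 145, 259, 267, 269, 278, 346, 356, 458, 467, 478, 568,
      689]
    flips := [629, 1728, 2305, 259, 3746]
    involution := [2, 9, 0, 7, 6, 8, 4, 3, 5, 1]
    positions := [(23, -12, 13), (-25, -8, 4), (-23, 12, 13), (-22, -25, 6), (25, 17, -14), (1, 7, 8),
      (-25, -17, -14), (22, 25, 6), (-1, -7, 8), (25, 8, 4)] },
  { triangles := [14, 18, 34, 38, 124, 126, 167, 178, 235, 239, 245, 269, 347, 356, 367, 389, 458, 478, 568,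
      689]
    flips := [629, 239, 938, 1524, 2716]
    involution := [9, 2, 1, 8, 6, 7, 4, 5, 3, 0]
    positions := [(3, -25, -8), (-2, 2, -12), (2, -2, -12), (-11, -25, -23), (-19, -4, 25), (12, -1, 3),
      (19, 4, 25), (-12, 1, 3), (11, 25, -23), (-3, 25, -8)] },
  { triangles := [14, 18, 34, 38, 145, 157, 178, 235, 239, 257, 267, 269, 347, 356, 367, 389, 458, 478, 568,
      689]
    flips := [629, 239, 938, 1257]
    involution := [9, 2, 1, 8, 6, 7, 4, 5, 3, 0]
    positions := [(25, 23, -18), (21, 1, -18), (-21, -1, -18), (25, 7, -25), (19, -25, 25), (-24, 13, -4),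
      (-19, 25, 25), (24, -13, -4), (-25, -7, -25), (-25, -23, -18)] },
  { triangles := [14, 18, 34, 39, 89, 145, 157, 178, 235, 239, 257, 267, 269, 347, 356, 367, 458, 478, 568,
      689]
    flips := [629, 239, 1257]
    involution := [9, 2, 1, 8, 6, 7, 4, 5, 3, 0]
    positions := [(-25, 25, -24), (-1, -5, -3), (1, 5, -3), (-25, -16, -25), (-7, -12, 17), (-1, 10, -2),
      (7, 12, 17), (1, -10, -2), (25, 16, -25), (25, -25, -24)] },
  { triangles := [14, 19, 23, 29, 37, 47, 125, 127, 145, 178, 189, 235, 267, 269, 356, 367, 458, 478, 569,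
      589]
    flips := [629, 819, 3407, 6859]
    involution := [9, 2, 1, 8, 6, 7, 4, 5, 3, 0]
    positions := [(4, -16, 11), (-25, 0, 25), (25, 0, 25), (-2, 25, 3), (4, -20, 14), (20, 5, 23),
      (-4, 20, 14), (-20, -5, 23), (2, -25, 3), (-4, 16, 11)] },
  { triangles := [15, 18, 23, 26, 34, 45, 69, 89, 123, 127, 135, 147, 148, 246, 247, 346, 356, 458, 568, 689]
    flips := [1405, 2513, 3746, 6724, 7814]
    involution := [4, 6, 8, 5, 0, 3, 1, 9, 2, 7]
    positions := [(12, -25, 25), (15, 10, -4), (-25, -25, -15), (22, -16, 12), (-12, 25, 25), (-22, 16, 12),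
      (-15, -10, -4), (9, 16, -16), (25, 25, -15), (-9, -16, -16)] },
  { triangles := [15, 18, 24, 26, 45, 69, 89, 125, 128, 234, 235, 267, 278, 346, 356, 458, 467, 478, 569, 589]
    flips := [324, 1405, 1728, 3746, 6859]
    involution := [4, 3, 5, 1, 0, 2, 8, 9, 6, 7]
    positions := [(-12, 18, 24), (-21, -16, 25), (7, -9, 11), (21, 16, 25), (12, -18, 24), (-7, 9, 11),
      (-15, 25, 25), (-24, 16, 21), (15, -25, 25), (24, -16, 21)] },
  { triangles := [15, 18, 34, 39, 45, 89, 125, 127, 178, 235, 239, 279, 347, 356, 367, 458, 478, 568, 679,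
      689]
    flips := [629, 239, 1405, 2679]
    involution := [9, 2, 1, 8, 6, 7, 4, 5, 3, 0]
    positions := [(1, -10, 11), (25, 22, 25), (-25, -22, 25), (-4, 11, -18), (2, -20, 23), (-21, 1, 18),
      (-2, 20, 23), (21, -1, 18), (4, -11, -18), (-1, 10, 11)] },
  { triangles := [15, 19, 23, 29, 34, 45, 125, 127, 178, 189, 235, 279, 347, 356, 367, 458, 478, 568, 679,
      689]
    flips := [629, 819, 1405, 2679]
    involution := [9, 2, 1, 8, 6, 7, 4, 5, 3, 0]
    positions := [(14, -14, 9), (-25, -11, -11), (25, 11, -11), (-25, 25, 25), (8, -19, 3), (10, 25, -14),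
      (-8, 19, 3), (-10, -25, -14), (25, -25, 25), (-14, 14, 9)] },
  { triangles := [23, 26, 34, 45, 58, 69, 89, 125, 127, 157, 235, 267, 347, 356, 367, 456, 468, 478, 578, 689]
    flips := [1405, 5846, 158, 1857]
    involution := [7, 9, 8, 4, 3, 6, 5, 0, 2, 1]
    positions := [(-9, 20, -22), (11, -19, -12), (25, 25, 0), (-23, 21, -20), (23, -21, -20), (-17, -12, -5),
      (17, 12, -5), (9, -20, -22), (-25, -25, 0), (-11, 19, -12)] },
  { triangles := [14, 18, 24, 29, 89, 125, 128, 145, 234, 235, 267, 269, 278, 347, 356, 367, 456, 469, 478,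
      489]
    flips := [324, 629, 1728, 5846, 6849]
    involution := [3, 5, 4, 0, 2, 1, 8, 9, 6, 7]
    positions := [(-28, 7, 22), (4, -2, 10), (-22, -21, -13), (28, -7, 22), (22, 21, -13), (-4, 2, 10),
      (-20, -2, 15), (-8, 30, 30), (20, 2, 15), (8, -30, 30)] },
  { triangles := [14, 18, 34, 39, 89, 123, 128, 135, 145, 239, 267, 269, 278, 347, 356, 367, 458, 478, 568,
      689]
    flips := [629, 239, 1728, 2513]
    involution := [9, 2, 1, 8, 6, 7, 4, 5, 3, 0]
    positions := [(30, 26, -18), (-20, 1, 1), (20, -1, 1), (24, -2, -30), (30, -30, 30), (-29, -1, 3),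
      (-30, 30, 30), (29, 1, 3), (-24, 2, -30), (-30, -26, -18)] },
  { triangles := [14, 19, 23, 29, 34, 124, 126, 167, 178, 189, 235, 245, 269, 347, 356, 367, 458, 478, 568,
      689]
    flips := [629, 819, 1524, 2716]
    involution := [9, 2, 1, 8, 6, 7, 4, 5, 3, 0]
    positions := [(26, -30, -29), (17, -30, 24), (-17, 30, 24), (-1, 1, -30), (-30, -13, 25), (28, -24, -24),
      (30, 13, 25), (-28, 24, -24), (1, -1, -30), (-26, 30, -29)] },
  { triangles := [14, 17, 23, 26, 34, 69, 78, 89, 125, 127, 145, 235, 267, 347, 357, 458, 478, 567, 569, 589]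
    flips := [1807, 3657, 6859]
    involution := [5, 3, 4, 1, 2, 0, 8, 7, 6, 9]
    positions := [(-8, -40, -37), (8, 27, -23), (26, 27, 26), (-8, -27, -23), (-26, -27, 26), (8, 40, -37),
      (-40, -40, 38), (0, 0, -17), (40, 40, 38), (0, 0, -34)] },
  { triangles := [15, 19, 45, 46, 69, 125, 126, 167, 178, 189, 234, 235, 246, 347, 357, 458, 478, 567, 568,
      689]
    flips := [324, 246, 819, 1405, 2716, 3657]
    involution := [2, 4, 0, 9, 1, 6, 5, 8, 7, 3]
    positions := [(-16, -23, -2), (-6, -3, -10), (16, 23, -2), (-9, 7, 40), (6, 3, -10), (-7, 38, -37),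
      (7, -38, -37), (-24, -38, 0), (24, 38, 0), (9, -7, 40)] },
  { triangles := [24, 26, 46, 125, 127, 145, 149, 168, 169, 178, 234, 235, 267, 347, 356, 367, 458, 469, 478,
      568]
    flips := [324, 819, 149, 946, 8916]
    involution := [9, 2, 1, 8, 6, 7, 4, 5, 3, 0]
    positions := [(40, -2, 40), (-18, -3, 16), (18, 3, 16), (-40, 4, 38), (-21, 40, -40), (8, -18, -22),
      (21, -40, -40), (-8, 18, -22), (40, -4, 38), (-40, 2, 40)] },
  { triangles := [14, 19, 24, 29, 145, 157, 168, 169, 178, 234, 235, 257, 267, 269, 347, 356, 367, 458, 478,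
      568]
    flips := [324, 629, 819, 1257, 8916]
    involution := [9, 2, 1, 8, 6, 7, 4, 5, 3, 0]
    positions := [(-34, 15, 2), (-59, -58, -59), (59, 58, -59), (-32, -32, -42), (-45, 39, 21),
      (53, -57, 34), (45, -39, 21), (-53, 57, 34), (32, 32, -42), (34, -15, 2)] },
  { triangles := [24, 26, 46, 145, 149, 157, 168, 169, 178, 234, 235, 257, 267, 347, 356, 367, 458, 469, 478,
      568]
    flips := [324, 819, 149, 946, 1257, 8916]
    involution := [9, 2, 1, 8, 6, 7, 4, 5, 3, 0]
    positions := [(200, 200, -58), (54, -98, 166), (-54, 98, 166), (113, -187, 200), (200, -6, -32),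
      (-59, -36, 73), (-200, 6, -32), (59, 36, 73), (-113, 187, 200), (-200, -200, -58)] }]

theorem mirrorData_check : mirrorData.all (SymmetricSurface.check true) = true := by
  decide +kernel

theorem halfTurnData_check : halfTurnData.all (SymmetricSurface.check false) = true := by
  decide +kernel

/-- The triangulations with a reflection, followed by those with a half-turn. -/
def symmetricSurfaces : List SymmetricSurface := mirrorData ++ halfTurnData

theorem nodup_computeInvariant :
    (symmetricSurfaces.map fun s => computeInvariant s.triangles).Nodup := by
  decide +kernel

theorem length_symmetricSurfaces : symmetricSurfaces.length = 76 := rfl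

theorem realizes_of_check {s : SymmetricSurface} {r : Bool} (h : s.check r = true) :
    IsTriangulationOf (triangleComplex s.triangles) KleinBottle ∧
      IsPolyhedralImmersion (triangleComplex s.triangles) (realization s.positions) ∧
      IsInvolutorySymmetry (triangleComplex s.triangles) (realization s.positions)
        (symmetryIsometry r) := by
  simp only [SymmetricSurface.check, Bool.and_eq_true] at h
  obtain ⟨⟨⟨⟨hl, hf⟩, hg⟩, hi⟩, hs⟩ := h
  exact ⟨isTriangulationOf_kleinBottle hl hf, isPolyhedralImmersion_realization hl hi,
    isInvolutorySymmetry_realization hl hg hs⟩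

theorem isTriangleList_of_check {s : SymmetricSurface} {r : Bool}
    (h : s.check r = true) : isTriangleList s.triangles = true := by
  simp only [SymmetricSurface.check, Bool.and_eq_true] at h
  exact h.1.1.1.1

/-- The first nine triangulations are realized with a reflection, the others with a half-turn. -/
theorem check_symmetricSurfaces {i : ℕ} (hi : i < symmetricSurfaces.length) :
    symmetricSurfaces[i].check (decide (i < 9)) = true := by
  have hlen : mirrorData.length = 9 := rfl
  simp only [symmetricSurfaces]
  by_cases h : i < 9
  · rw [List.getElem_append_left (by omega), decide_eq_true h]
    exact List.all_eq_true.1 mirrorData_check _ (List.getElem_mem _)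
  · rw [List.getElem_append_right (by omega), decide_eq_false h]
    exact List.all_eq_true.1 halfTurnData_check _ (List.getElem_mem _)

theorem theorem3 :
    ∃ K : Fin 76 → AbstractSimplicialComplex (Fin 10),
      (∀ i, IsTriangulationOf (K i) KleinBottle) ∧
      (∀ i j, i ≠ j → IsEmpty (ComplexIso (K i) (K j))) ∧
      ∀ i, ∃ (ψ : Fin 10 → EuclideanSpace ℝ (Fin 3))
        (T : EuclideanSpace ℝ (Fin 3) ≃ᵃⁱ[ℝ] EuclideanSpace ℝ (Fin 3)),
        IsPolyhedralImmersion (K i) ψ ∧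
        IsInvolutorySymmetry (K i) ψ T ∧
        (i.val < 9 → IsPlaneReflection T) ∧ (9 ≤ i.val → IsTwofoldRotation T) := by
  have hlen (i : Fin 76) : i.val < symmetricSurfaces.length := by
    rw [length_symmetricSurfaces]; exact i.2
  let s (i : Fin 76) : SymmetricSurface := symmetricSurfaces[i.val]'(hlen i)
  have hs (i : Fin 76) : (s i).check (decide (i.val < 9)) = true := check_symmetricSurfaces (hlen i)
  refine ⟨fun i => triangleComplex (s i).triangles, fun i => (realizes_of_check (hs i)).1,
    fun i j hij => ?_, fun i => ⟨realization (s i).positions,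
      symmetryIsometry (decide (i.val < 9)), (realizes_of_check (hs i)).2.1,
      (realizes_of_check (hs i)).2.2, fun hi => ?_, fun hi => ?_⟩⟩
  · refine isEmpty_complexIso (isTriangleList_of_check (hs i)) (isTriangleList_of_check (hs j))
      fun h => hij (Fin.ext ?_)
    refine (List.Nodup.getElem_inj_iff nodup_computeInvariant (hi := ?_) (hj := ?_)).1 ?_
    · rw [List.length_map]; exact hlen i
    · rw [List.length_map]; exact hlen j
    · rw [List.getElem_map, List.getElem_map]; exact h
  · rw [decide_eq_true hi]
    exact isPlaneReflection_thirdAxis_orthogonal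
  · rw [decide_eq_false (by omega)]
    exact isTwofoldRotation_thirdAxis
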